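/- **Setting.** Fix $d\in\mathbb N$, the scaling $\mathfrak s=(2,1,\dots,1)$ on $\mathbb N^{d+1}$ with $|k|_{\mathfrak s}=\sum_j\mathfrak s_jk_j$, real numbers $\alpha$ and $\kappa>0$, an integrable compactly supported kernel $K:\mathbb R^{d+1}\to\mathbb R$ with $\int K(z)z^k\,dz=0$ for all $|k|_{\mathfrak s}<r$ ($r\in\mathbb R$), and smooth functions $\xi,\delta\xi:\mathbb R^{d+1}\to\mathbb R$. Expressions $\partial^aK*f$ are understood as $\partial^a(K*f)$. *Trees.* $T$ is the set of decorated (non-planar rooted) trees $X^k\Xi^l\dot\Xi^m\prod_i\mathcal I_{a_i}(\tau_i)$ with the commutative tree product, $\mathcal T$ its linear span, with the convention $\mathcal I_a(X^k)=0$; $T_0\subset T$ are the trees without $\dot\Xi$, and $\mathcal T_0$ is their span. The degrees $\deg_i$ ($i=0,1,2$) are additive under products with $\deg_i(X_j)=\mathfrak s_j$, $\deg_i(\Xi)=\alpha$, $\deg_i(\mathcal I_a\tau)=\deg_i(\tau)+2-|a|_{\mathfrak s}$ and $\deg_0(\dot\Xi)=\alpha$, $\deg_1(\dot\Xi)=\alpha+\frac{d+2}2$,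 $\deg_2(\dot\Xi)=\alpha+\frac{d+2}2+2\kappa$; assume $\deg_2(\dot\Xi)>0$. $D_\Xi:\mathcal T_0\to\mathcal T$ is the derivation with $D_\Xi\Xi=\dot\Xi$, $D_\Xi X^k=0$, $D_\Xi\mathcal I_a(\tau)=\mathcal I_a(D_\Xi\tau)$. *Co-actions.* $\mathcal T^{+,i}$ is the free commutative algebra on the $X_j$, the symbols $\mathcal I^{+,i}_a(\tau)$ with $\tau\in T$ not a monomial and $\deg_i(\mathcal I_a\tau)>0$, and, for $i=2$, $\dot\Xi$; put $\mathcal I_a^{+,i}(\tau)=0$ for all other $\tau\in T$. The multiplicative map $\Delta_i:\mathcal T\to\mathcal T\otimes\mathcal T^{+,i}$ is given by $\Delta_iX_j=X_j\otimes\mathbf 1+\mathbf 1\otimes X_j$, $\Delta_i\Xi=\Xi\otimes\mathbf 1$, $\Delta_i\dot\Xi=\dot\Xi\otimes\mathbf 1+1_{i=2}\,\mathbf 1\otimes\dot\Xi$ and $$\Delta_i\mathcal I_a(\tau)=(\mathcal I_a\otimes\mathrm{id})\Delta_i\tau+\sum_{|\ell+m|_{\mathfrak s}<\deg_i(\mathcal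 I_a\tau)}\frac{X^\ell}{\ell!}\otimes\frac{X^m}{m!}\mathcal I^{+,i}_{a+\ell+m}(\tau).$$ The multiplicative coproduct $\Delta_i^+$ on $\mathcal T^{+,i}$ has $X_j$ and $\dot\Xi$ primitive and $\Delta^+_i\mathcal I^{+,i}_a(\tau)=\sum_{|\ell|_{\mathfrak s}<\deg_i(\mathcal I_a\tau)}\big(\mathcal I^{+,i}_{a+\ell}\otimes\frac{(-X)^\ell}{\ell!}\big)\Delta_i\tau+\mathbf 1\otimes\mathcal I^{+,i}_a(\tau)$; $\mathcal A^+_i$ is its antipode. The multiplicative map $\hat\Delta_2:\mathcal T\to\mathcal T\otimes\mathcal T^{+,2}$ is given by $\hat\Delta_2X_j=X_j\otimes\mathbf 1$, $\hat\Delta_2\Xi=\Xi\otimes\mathbf 1$, $\hat\Delta_2\dot\Xi=\dot\Xi\otimes\mathbf 1-\mathbf 1\otimes\dot\Xi$ and $$\hat\Delta_2\mathcal I_a(\tau)=(\mathcal I_a\otimes\mathrm{id})\hat\Delta_2\tau-\sum_{|\ell|_{\mathfrak s}\ge\deg_0(\mathcal I_a\tau)}\frac{X^\ell}{\ell!}\otimes\mathcal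 M\big(\mathcal I^{+,2}_{a+\ell}\otimes\mathrm{id}\big)\hat\Delta_2\tau,$$ where $\mathcal M$ is the multiplication of $\mathcal T^{+,2}$. *Model.* Let $R:\mathcal T\to\mathcal T$ be a preparation map: it is linear, fixes monomials, $\Xi$, $\dot\Xi$ and planted trees; for every tree $\tau$, $R\tau-\tau$ is a combination of trees $\sigma$ with $\deg_0\sigma\ge\deg_0\tau$ and strictly fewer noises ($\Xi$ or $\dot\Xi$) than $\tau$; $(R\otimes\mathrm{id})\Delta_i=\Delta_iR$ for $i=0,1,2$; and $RD_\Xi=D_\Xi R$ on $\mathcal T_0$. The maps $\Pi^2_x=\Pi^{2,\times}_xR$ are defined by $\Pi^{2,\times}_x$ being multiplicative with $\Pi^{2,\times}_xX^k=(\cdot-x)^k$, $\Pi^{2,\times}_x\Xi=\xi$, $\Pi^{2,\times}_x\dot\Xi=\delta\xi-\delta\xi(x)$ and $$(\Pi^{2,\times}_x\mathcal I_a\tau)(y)=(\partial^aK*\Pi^2_x\tau)(y)-\sum_{|k|_{\mathfrak s}<\deg_2(\mathcal I_a\tau)}\frac{(y-x)^k}{k!}(\partial^{a+k}K*\Pi^2_x\tau)(x).$$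 Let $f^2_x:\mathcal T^{+,2}\to\mathbb R$ be the character with $f^2_x(X_j)=-x_j$, $f^2_x(\dot\Xi)=-\delta\xi(x)$ and $f^2_x(\mathcal I^{+,2}_a(\tau))=-(\partial^aK*\Pi^2_x\tau)(x)$ on the generators, and $$\Gamma^2_{xy}=\big(\mathrm{id}\otimes(f^2_x\mathcal A^+_2\otimes f^2_y)\Delta^+_2\big)\Delta_2,\qquad \mathcal J^2_a(x)\tau=\sum_{|k|_{\mathfrak s}<\deg_2(\mathcal I_a\tau)}(\partial^{a+k}K*\Pi^2_x\tau)(x)\frac{X^k}{k!}\quad(\tau\in T),$$ $$\mathrm d\Gamma^2_{yx}=(\Gamma^2_{yx}\otimes f^2_x)\hat\Delta_2D_\Xi .$$ Let $P_\eta$ be the linear projection of $\mathcal T$ that keeps the trees $\tau$ with $\deg_2\tau<\eta$ and sends all other trees to $0$. **Theorem.** For all $x,y\in\mathbb R^{d+1}$: 1. $\mathrm d\Gamma^2_{yx}\Xi=\dot\Xi+\delta\xi(y)\mathbf 1$, and $\mathrm d\Gamma^2_{yx}X^k=0$ for all $k\in\mathbb N^{d+1}$; 2. $\mathrm d\Gamma^2_{yx}(\sigma\tau)=\mathrm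 d\Gamma^2_{yx}\tau\;\Gamma^2_{yx}\sigma+\Gamma^2_{yx}\tau\;\mathrm d\Gamma^2_{yx}\sigma$ for all $\sigma,\tau\in\mathcal T_0$; 3. for every $a\in\mathbb N^{d+1}$ and every tree $\tau\in T_0$ with $\deg_0(\tau)+\frac{d+2}2+2\kappa\le r$ (that is, $K$ annihilates monomials up to a sufficiently high degree), $$\mathrm d\Gamma^2_{yx}\mathcal I_a(\tau)=\big(\mathcal I_a+\mathcal J^2_a(y)\big)\big(\mathrm d\Gamma^2_{yx}\tau\big)-\Gamma^2_{yx}\,P_{\deg_0(\mathcal I_a\tau)}\big(\mathcal J^2_a(x)(\mathrm d\Gamma^2_{xx}\tau)\big).$$ -/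

import Mathlib

open scoped TensorProduct ContDiff

noncomputable section

namespace DecTree

/-! ### Multi-indices -/

/-- Multi-indices in `ℕ^{d+1}`; the coordinate `0` is time. -/
abbrev MI (d : ℕ) := Fin (d + 1) → ℕ

/-- Space-time points of `ℝ^{d+1}`. -/
abbrev Pt (d : ℕ) := Fin (d + 1) → ℝ

/-- The parabolic scaling `(2,1,…,1)`. -/
def scaling {d : ℕ} (j : Fin (d + 1)) : ℕ := if j = 0 then 2 else 1

/-- The scaled size `|k|_𝔰 = ∑ 𝔰_j k_j`. -/
def MI.size {d : ℕ} (k : MI d) : ℕ := ∑ j, scaling j * k j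

/-- The multi-index factorial `k!`. -/
def MI.fact {d : ℕ} (k : MI d) : ℕ := ∏ j, (k j).factorial

theorem le_size {d : ℕ} (k : MI d) (j : Fin (d + 1)) : k j ≤ k.size := by
  have h1 : 1 ≤ scaling j := by unfold scaling; split <;> omega
  calc k j ≤ scaling j * k j := Nat.le_mul_of_pos_left _ h1
    _ ≤ k.size := Finset.single_le_sum (f := fun j => scaling j * k j)
        (fun _ _ => Nat.zero_le _) (Finset.mem_univ j)

theorem finite_below (d : ℕ) (c : ℝ) : {k : MI d | (k.size : ℝ) < c}.Finite := by
  refine (Set.finite_Iic (fun _ : Fin (d + 1) => ⌈c⌉₊)).subset fun k hk j => ?_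
  have h1 : (MI.size k : ℝ) < ⌈c⌉₊ := lt_of_lt_of_le hk (Nat.le_ceil c)
  exact (le_size k j).trans (by exact_mod_cast h1.le)

/-- The finite set of all multi-indices with `|k|_𝔰 < c`. -/
def below (d : ℕ) (c : ℝ) : Finset (MI d) := (finite_below d c).toFinset

@[simp] theorem mem_below {d : ℕ} {c : ℝ} {k : MI d} : k ∈ below d c ↔ (k.size : ℝ) < c := by
  simp [below]

/-! ### Decorated trees -/

/-- Symbolic expressions for decorated trees.  The Boolean index is `true` exactly for the
expressions that denote a monomial `X^k`; only the other ones may be grafted, which implements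
the convention `𝓘_a(X^k) = 0`. -/
inductive Pre (d : ℕ) : Bool → Type
  | X (k : MI d) : Pre d true
  | noise : Pre d false
  | dnoise : Pre d false
  | mul {b c : Bool} (s : Pre d b) (t : Pre d c) : Pre d (b && c)
  | plant (a : MI d) (t : Pre d false) : Pre d false

/-- Two expressions denote the same (non-planar) decorated tree: the tree product is associative
and commutative with unit `X^0`, and the decorations of merged roots add up. -/
inductive Rel {d : ℕ} : ∀ {b c : Bool}, Pre d b → Pre d c → Prop
  | refl {b} (s : Pre d b) : Rel s s
  | symm {b c} {s : Pre d b} {t : Pre d c} : Rel s t → Rel t s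
  | trans {b c e} {s : Pre d b} {t : Pre d c} {u : Pre d e} : Rel s t → Rel t u → Rel s u
  | mul_congr {b c b' c'} {s : Pre d b} {t : Pre d c} {s' : Pre d b'} {t' : Pre d c'} :
      Rel s s' → Rel t t' → Rel (Pre.mul s t) (Pre.mul s' t')
  | plant_congr (a : MI d) {s t : Pre d false} : Rel s t → Rel (Pre.plant a s) (Pre.plant a t)
  | mul_assoc {b c e} (s : Pre d b) (t : Pre d c) (u : Pre d e) :
      Rel (Pre.mul (Pre.mul s t) u) (Pre.mul s (Pre.mul t u))
  | mul_comm {b c} (s : Pre d b) (t : Pre d c) : Rel (Pre.mul s t) (Pre.mul t s)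
  | one_mul {b} (s : Pre d b) : Rel (Pre.mul (Pre.X 0) s) s
  | X_mul (k l : MI d) : Rel (Pre.mul (Pre.X k) (Pre.X l)) (Pre.X (k + l))

theorem Rel.index_eq {d : ℕ} {b c : Bool} {s : Pre d b} {t : Pre d c} (h : Rel s t) : b = c := by
  induction h with
  | refl _ => rfl
  | symm _ ih => exact ih.symm
  | trans _ _ h1 h2 => exact h1.trans h2
  | mul_congr _ _ h1 h2 => rw [h1, h2]
  | plant_congr _ _ _ => rfl
  | mul_assoc _ _ _ => exact Bool.and_assoc _ _ _
  | mul_comm _ _ => exact Bool.and_comm _ _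
  | one_mul _ => exact Bool.true_and _
  | X_mul _ _ => rfl

/-- Expressions modulo equality of decorated trees. -/
def treeSetoid (d : ℕ) : Setoid (Σ b, Pre d b) where
  r p q := Rel p.2 q.2
  iseqv := ⟨fun p => Rel.refl p.2, fun h => Rel.symm h, fun h1 h2 => Rel.trans h1 h2⟩

/-- The set `T` of decorated trees
`X^k Ξ^l Ξ̇^m ∏ 𝓘_{a_i}(τ_i)` (with no `τ_i` equal to a monomial). -/
def Tree (d : ℕ) : Type := Quotient (treeSetoid d)

namespace Tree

variable {d : ℕ}

/-- The tree denoted by an expression. -/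
def mk {b : Bool} (t : Pre d b) : Tree d := Quotient.mk (treeSetoid d) ⟨b, t⟩

theorem mk_eq {b c : Bool} {s : Pre d b} {t : Pre d c} (h : Rel s t) : mk s = mk t :=
  Quotient.sound (s := treeSetoid d) h

/-- Trees form a commutative monoid under the tree product. -/
instance : CommMonoid (Tree d) where
  one := mk (Pre.X 0)
  mul := Quotient.map₂ (fun p q => ⟨_, Pre.mul p.2 q.2⟩) fun _ _ h1 _ _ h2 => Rel.mul_congr h1 h2
  mul_assoc := by
    rintro ⟨_, s⟩ ⟨_, t⟩ ⟨_, u⟩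
    exact mk_eq (Rel.mul_assoc s t u)
  mul_comm := by
    rintro ⟨_, s⟩ ⟨_, t⟩
    exact mk_eq (Rel.mul_comm s t)
  one_mul := by
    rintro ⟨_, s⟩
    exact mk_eq (Rel.one_mul s)
  mul_one := by
    rintro ⟨_, s⟩
    exact (mk_eq (Rel.mul_comm s (Pre.X 0))).trans (mk_eq (Rel.one_mul s))

/-- The monomial `X^k`. -/
def X (k : MI d) : Tree d := mk (Pre.X k)

/-- The noise `Ξ`. -/
def noise : Tree d := mk Pre.noise

/-- The perturbed noise `Ξ̇`. -/
def dnoise : Tree d := mk Pre.dnoise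

/-- The tree is a monomial `X^k`. -/
def IsPoly (τ : Tree d) : Prop := ∃ k, τ = X k

/-- The planted tree `𝓘_a(τ)`, for `τ` not a monomial (the value at a monomial is never used:
there `𝓘_a` is `0`, see `graft`). -/
def plant (a : MI d) : Tree d → Tree d :=
  Quotient.lift (s := treeSetoid d)
    (fun p => match p with
      | ⟨true, _⟩ => 1
      | ⟨false, t⟩ => mk (Pre.plant a t))
    (by
      rintro ⟨b, s⟩ ⟨c, t⟩ h
      have hbc : b = c := Rel.index_eq h
      subst hbc
      cases b
      · exact mk_eq (Rel.plant_congr a h)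
      · rfl)

theorem mk_mul {b c : Bool} (s : Pre d b) (t : Pre d c) : mk (Pre.mul s t) = mk s * mk t := rfl

theorem X_zero : (X 0 : Tree d) = 1 := rfl

theorem X_add (k l : MI d) : X (k + l) = X k * X l := (mk_eq (Rel.X_mul k l)).symm

theorem plant_mk (a : MI d) (t : Pre d false) : plant a (mk t) = mk (Pre.plant a t) := rfl

theorem isPoly_of_true : ∀ {b : Bool} (t : Pre d b), b = true → IsPoly (mk t)
  | _, .X k, _ => ⟨k, rfl⟩
  | _, .noise, h => by simp at h
  | _, .dnoise, h => by simp at h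
  | _, .mul s t, h => by
      rw [Bool.and_eq_true] at h
      obtain ⟨k, hk⟩ := isPoly_of_true s h.1
      obtain ⟨l, hl⟩ := isPoly_of_true t h.2
      exact ⟨k + l, by rw [mk_mul, hk, hl, X_add]⟩
  | _, .plant _ _, h => by simp at h

theorem isPoly_mk {b : Bool} (t : Pre d b) : IsPoly (mk t) ↔ b = true := by
  refine ⟨fun ⟨k, hk⟩ => ?_, isPoly_of_true t⟩
  exact Rel.index_eq (Quotient.exact (s := treeSetoid d) hk)

/-- Induction along the tree structure. -/
theorem induction {P : Tree d → Prop} (hX : ∀ k, P (X k)) (hn : P noise) (hd : P dnoise)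
    (hm : ∀ σ τ, P σ → P τ → P (σ * τ)) (hp : ∀ a τ, ¬ IsPoly τ → P τ → P (plant a τ))
    (τ : Tree d) : P τ := by
  have key : ∀ {b : Bool} (t : Pre d b), P (mk t) := by
    intro b t
    induction t with
    | X k => exact hX k
    | noise => exact hn
    | dnoise => exact hd
    | mul s t ih1 ih2 => exact hm _ _ ih1 ih2
    | plant a t ih => exact hp a (mk t) (by simp [isPoly_mk]) ih
  induction τ using Quotient.inductionOn with
  | h p => exact key p.2

section Lift

variable {M : Type*} [CommMonoid M] (g : Fin (d + 1) → M) (n dn : M)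
  (pl : MI d → Tree d → M → M)

/-- Auxiliary recursion on expressions for `Tree.lift`. -/
def preLift : ∀ {b : Bool}, Pre d b → M
  | _, .X k => ∏ j, g j ^ k j
  | _, .noise => n
  | _, .dnoise => dn
  | _, .mul s t => preLift s * preLift t
  | _, .plant a t => pl a (mk t) (preLift t)

theorem preLift_congr {b c : Bool} {s : Pre d b} {t : Pre d c} (h : Rel s t) :
    preLift g n dn pl s = preLift g n dn pl t := by
  induction h with
  | refl _ => rfl
  | symm _ ih => exact ih.symm
  | trans _ _ h1 h2 => exact h1.trans h2
  | mul_congr _ _ h1 h2 => simp only [preLift, h1, h2]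
  | plant_congr a h ih => simp only [preLift, ih, mk_eq h]
  | mul_assoc _ _ _ => simp only [preLift, _root_.mul_assoc]
  | mul_comm s t => simp only [preLift]; exact _root_.mul_comm _ _
  | one_mul _ => simp [preLift]
  | X_mul k l => simp [preLift, pow_add, Finset.prod_mul_distrib]

/-- The multiplicative map `φ` on trees determined recursively by `φ(X_j) = g j`, `φ(Ξ) = n`,
`φ(Ξ̇) = dn` and `φ(𝓘_a τ) = pl a τ (φ τ)`. -/
def lift : Tree d →* M where
  toFun := Quotient.lift (s := treeSetoid d) (fun p => preLift g n dn pl p.2)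
    (fun _ _ h => preLift_congr g n dn pl h)
  map_one' := by
    change preLift g n dn pl (Pre.X 0) = 1
    simp [preLift]
  map_mul' := by
    rintro ⟨_, s⟩ ⟨_, t⟩
    rfl

theorem lift_X (k : MI d) : lift g n dn pl (X k) = ∏ j, g j ^ k j := rfl

theorem lift_noise : lift g n dn pl noise = n := rfl

theorem lift_dnoise : lift g n dn pl dnoise = dn := rfl

theorem lift_plant (a : MI d) {τ : Tree d} (h : ¬ IsPoly τ) :
    lift g n dn pl (plant a τ) = pl a τ (lift g n dn pl τ) := by
  induction τ using Quotient.inductionOn with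
  | h p =>
    obtain ⟨b, t⟩ := p
    cases b
    · rfl
    · exact absurd (isPoly_of_true t rfl) h

end Lift

/-- The number `|τ|_Ξ` of noises of either type. -/
def noiseCount (τ : Tree d) : ℕ :=
  (lift (M := Multiplicative ℕ) (fun _ => 1) (.ofAdd 1) (.ofAdd 1) (fun _ _ v => v) τ).toAdd

/-- The number of noises `Ξ̇`. -/
def dnoiseCount (τ : Tree d) : ℕ :=
  (lift (M := Multiplicative ℕ) (fun _ => 1) 1 (.ofAdd 1) (fun _ _ v => v) τ).toAdd

end Tree

/-! ### Degrees -/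

section Degrees

variable {d : ℕ} (α κ : ℝ)

/-- The degree `deg_i(Ξ̇)`, where `α = deg_i(Ξ)`. -/
def degDnoise (d : ℕ) (α κ : ℝ) (i : Fin 3) : ℝ :=
  if i = 0 then α else if i = 1 then α + ((d : ℝ) + 2) / 2 else α + ((d : ℝ) + 2) / 2 + 2 * κ

/-- The degree map `deg_i` on trees. -/
def deg (i : Fin 3) (τ : Tree d) : ℝ :=
  (Tree.lift (M := Multiplicative ℝ) (fun j => .ofAdd (scaling j : ℝ)) (.ofAdd α)
    (.ofAdd (degDnoise d α κ i)) (fun a _ v => .ofAdd (v.toAdd + 2 - (a.size : ℝ))) τ).toAdd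

/-- `deg_i(𝓘_a(τ)) = deg_i(τ) + 2 - |a|_𝔰`. -/
def degI (i : Fin 3) (a : MI d) (τ : Tree d) : ℝ := deg α κ i τ + 2 - (a.size : ℝ)

end Degrees

/-! ### The linear span of trees -/

/-- The linear span `𝓣` of `T`, with the tree product. -/
abbrev Span (d : ℕ) := MonoidAlgebra ℝ (Tree d)

section Span

variable {d : ℕ}

/-- A tree as an element of the linear span. -/
def tr (τ : Tree d) : Span d := MonoidAlgebra.of ℝ (Tree d) τ

/-- The linear extension of a map defined on trees. -/
def extend {V : Type*} [AddCommGroup V] [Module ℝ V] (f : Tree d → V) : Span d →ₗ[ℝ] V :=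
  (Finsupp.linearCombination ℝ f) ∘ₗ (MonoidAlgebra.coeffLinearEquiv ℝ).toLinearMap

theorem extend_tr {V : Type*} [AddCommGroup V] [Module ℝ V] (f : Tree d → V) (τ : Tree d) :
    extend f (tr τ) = f τ := by
  simp [extend, tr, MonoidAlgebra.of_apply, MonoidAlgebra.coeff_single]

/-- The monomial `X^k` in the linear span. -/
def Xs (k : MI d) : Span d := tr (Tree.X k)

open Classical in
/-- The operator `𝓘_a`, with `𝓘_a(X^k) = 0`. -/
def graft (a : MI d) : Span d →ₗ[ℝ] Span d :=
  extend fun τ => if τ.IsPoly then 0 else tr (τ.plant a)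

/-- The span `𝓣_0` of the trees that contain no `Ξ̇`. -/
def Span0 (d : ℕ) : Submodule ℝ (Span d) :=
  Submodule.span ℝ {v | ∃ τ : Tree d, τ.dnoiseCount = 0 ∧ v = tr τ}

open Classical in
/-- The canonical projection `P_η` onto trees of homogeneity `deg_2` less than `η`. -/
def proj (α κ η : ℝ) : Span d →ₗ[ℝ] Span d :=
  extend fun τ => if deg α κ 2 τ < η then tr τ else 0

/-- Auxiliary recursion on expressions for `DXi`. -/
def preDXi : ∀ {b : Bool}, Pre d b → Span d
  | _, .X _ => 0
  | _, .noise => tr Tree.dnoise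
  | _, .dnoise => 0
  | _, .mul s t => preDXi s * tr (Tree.mk t) + tr (Tree.mk s) * preDXi t
  | _, .plant a t => graft a (preDXi t)

theorem tr_mul (σ τ : Tree d) : tr (σ * τ) = tr σ * tr τ := map_mul _ σ τ

theorem preDXi_congr {b c : Bool} {s : Pre d b} {t : Pre d c} (h : Rel s t) :
    preDXi s = preDXi t := by
  induction h with
  | refl _ => rfl
  | symm _ ih => exact ih.symm
  | trans _ _ h1 h2 => exact h1.trans h2
  | mul_congr h1 h2 ih1 ih2 => simp only [preDXi, ih1, ih2, Tree.mk_eq h1, Tree.mk_eq h2]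
  | plant_congr a _ ih => simp only [preDXi, ih]
  | mul_assoc _ _ _ => simp only [preDXi, Tree.mk_mul, tr_mul]; ring
  | mul_comm s t => simp only [preDXi]; ring
  | one_mul s =>
    have : tr (Tree.mk (Pre.X (0 : MI d))) = 1 := map_one (MonoidAlgebra.of ℝ (Tree d))
    simp [preDXi, this]
  | X_mul k l => simp [preDXi]

/-- The abstract Malliavin derivative of a tree. -/
def treeDXi : Tree d → Span d :=
  Quotient.lift (s := treeSetoid d) (fun p => preDXi p.2) fun _ _ h => preDXi_congr h

/-- The abstract Malliavin derivative: the derivation with `D_Ξ Ξ = Ξ̇`, `D_Ξ X^k = 0` and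
`D_Ξ 𝓘_a(τ) = 𝓘_a(D_Ξ τ)` (extended by `D_Ξ Ξ̇ = 0`). -/
def DXi : Span d →ₗ[ℝ] Span d := extend treeDXi

theorem DXi_X (k : MI d) : DXi (tr (Tree.X k)) = 0 := by
  rw [DXi, extend_tr]; rfl

theorem DXi_noise : DXi (tr (Tree.noise : Tree d)) = tr Tree.dnoise := by
  rw [DXi, extend_tr]; rfl

theorem DXi_mul (σ τ : Tree d) :
    DXi (tr (σ * τ)) = DXi (tr σ) * tr τ + tr σ * DXi (tr τ) := by
  simp only [DXi, extend_tr]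
  induction σ using Quotient.inductionOn with
  | h p =>
    induction τ using Quotient.inductionOn with
    | h q => rfl

theorem DXi_plant (a : MI d) {τ : Tree d} (h : ¬ τ.IsPoly) :
    DXi (tr (τ.plant a)) = graft a (DXi (tr τ)) := by
  simp only [DXi, extend_tr]
  induction τ using Quotient.inductionOn with
  | h p =>
    obtain ⟨b, t⟩ := p
    cases b
    · rfl
    · exact absurd (Tree.isPoly_of_true t rfl) h

end Span

/-! ### The algebras `𝓣^{+,i}`, co-actions, coproducts and antipodes -/

section Hopf

variable {d : ℕ} (α κ : ℝ) (i : Fin 3)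

/-- Generators of `𝓣^{+,i}`: the `X_j`, the `𝓘^{+,i}_a(τ)` with `deg_i(𝓘_a(τ)) > 0`
(`τ` not a monomial) and, for `i = 2` only, the symbol `Ξ̇`. -/
inductive PlusGen (d : ℕ) (α κ : ℝ) (i : Fin 3) : Type
  | X (j : Fin (d + 1)) : PlusGen d α κ i
  | dnoise (h : i = 2) : PlusGen d α κ i
  | I (a : MI d) (τ : Tree d) (hp : ¬ τ.IsPoly) (hd : 0 < degI α κ i a τ) : PlusGen d α κ i

/-- The commutative algebra `𝓣^{+,i}`. -/
abbrev Plus (d : ℕ) (α κ : ℝ) (i : Fin 3) := MvPolynomial (PlusGen d α κ i) ℝ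

/-- The monomial `X^k` in `𝓣^{+,i}`. -/
def Xp (k : MI d) : Plus d α κ i := ∏ j, MvPolynomial.X (PlusGen.X j) ^ k j

/-- The symbol `Ξ̇` of `𝓣^{+,2}` (and `0` for `i ≠ 2`). -/
def dnoisep : Plus d α κ i := if h : i = 2 then MvPolynomial.X (PlusGen.dnoise h) else 0

open Classical in
/-- The operator `𝓘^{+,i}_a : 𝓣 → 𝓣^{+,i}`, with `𝓘^{+,i}_a(τ) = 0` if `deg_i(𝓘_a(τ)) ≤ 0` and
`𝓘^{+,i}_a(X^k) = 0`. -/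
def Ip (a : MI d) : Span d →ₗ[ℝ] Plus d α κ i :=
  extend fun τ =>
    if h : ¬ τ.IsPoly ∧ 0 < degI α κ i a τ then MvPolynomial.X (PlusGen.I a τ h.1 h.2) else 0

/-- The co-action `Δ_i` on trees. -/
def treeCoact : Tree d →* Span d ⊗[ℝ] Plus d α κ i :=
  Tree.lift
    (fun j => Xs (Pi.single j 1) ⊗ₜ 1 + 1 ⊗ₜ MvPolynomial.X (PlusGen.X j))
    (tr Tree.noise ⊗ₜ 1)
    (tr Tree.dnoise ⊗ₜ 1 + 1 ⊗ₜ dnoisep α κ i)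
    (fun a τ v => TensorProduct.map (graft a) LinearMap.id v +
      ∑ l ∈ below d (degI α κ i a τ), ∑ m ∈ below d (degI α κ i a τ - (l.size : ℝ)),
        ((l.fact : ℝ)⁻¹ • Xs l) ⊗ₜ
          ((m.fact : ℝ)⁻¹ • (Xp α κ i m * Ip α κ i (a + l + m) (tr τ))))

/-- The co-action `Δ_i : 𝓣 → 𝓣 ⊗ 𝓣^{+,i}`. -/
def coact : Span d →ₐ[ℝ] Span d ⊗[ℝ] Plus d α κ i :=
  MonoidAlgebra.lift ℝ _ _ (treeCoact α κ i)

theorem coact_tr (τ : Tree d) : coact α κ i (tr τ) = treeCoact α κ i τ := by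
  rw [coact, tr, MonoidAlgebra.lift_of]

/-- The coproduct `Δ⁺_i : 𝓣^{+,i} → 𝓣^{+,i} ⊗ 𝓣^{+,i}`. -/
def coprod : Plus d α κ i →ₐ[ℝ] Plus d α κ i ⊗[ℝ] Plus d α κ i :=
  MvPolynomial.aeval fun q => match q with
    | .X j => MvPolynomial.X (PlusGen.X j) ⊗ₜ 1 + 1 ⊗ₜ MvPolynomial.X (PlusGen.X j)
    | .dnoise h => MvPolynomial.X (PlusGen.dnoise h) ⊗ₜ 1 + 1 ⊗ₜ MvPolynomial.X (PlusGen.dnoise h)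
    | .I a τ _ _ =>
        (∑ l ∈ below d (degI α κ i a τ),
          TensorProduct.map (Ip α κ i (a + l))
            (LinearMap.mulLeft ℝ (((l.fact : ℝ)⁻¹ * (-1) ^ (∑ j, l j)) • Xp α κ i l))
            (coact α κ i (tr τ))) +
        1 ⊗ₜ Ip α κ i a (tr τ)

/-- The linear map `τ₁ ⊗ p ↦ ∑_ℓ 𝓘^{+,i}_{a+ℓ}(τ₁) (X^ℓ / ℓ!) p` (summands with
`|ℓ|_𝔰 ≥ deg_i(𝓘_a(τ₁))` vanish, since then `𝓘^{+,i}_{a+ℓ}(τ₁) = 0`). -/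
def antipodeSum (a : MI d) : Span d ⊗[ℝ] Plus d α κ i →ₗ[ℝ] Plus d α κ i :=
  TensorProduct.lift ((LinearMap.mul ℝ (Plus d α κ i)).compl₁₂
    (extend fun τ => ∑ l ∈ below d (degI α κ i a τ),
      (l.fact : ℝ)⁻¹ • (Ip α κ i (a + l) (tr τ) * Xp α κ i l)) LinearMap.id)

/-- The map `(id ⊗ 𝓐⁺_i) Δ_i` on trees, constructed recursively together with the antipode
(see `coactAntipode_eq`). -/
def coactAntipode : Tree d →* Span d ⊗[ℝ] Plus d α κ i :=
  Tree.lift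
    (fun j => Xs (Pi.single j 1) ⊗ₜ 1 + 1 ⊗ₜ (-MvPolynomial.X (PlusGen.X j)))
    (tr Tree.noise ⊗ₜ 1)
    (tr Tree.dnoise ⊗ₜ 1 + 1 ⊗ₜ (-dnoisep α κ i))
    (fun a τ v => TensorProduct.map (graft a) LinearMap.id v +
      ∑ l ∈ below d (degI α κ i a τ), ∑ m ∈ below d (degI α κ i a τ - (l.size : ℝ)),
        ((l.fact : ℝ)⁻¹ • Xs l) ⊗ₜ
          ((m.fact : ℝ)⁻¹ • (((-1 : ℝ) ^ (∑ j, m j) • Xp α κ i m) *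
            (-antipodeSum α κ i (a + l + m) v))))

/-- The antipode `𝓐⁺_i` of `𝓣^{+,i}`. -/
def antipode : Plus d α κ i →ₐ[ℝ] Plus d α κ i :=
  MvPolynomial.aeval fun q => match q with
    | .X j => -MvPolynomial.X (PlusGen.X j)
    | .dnoise h => -MvPolynomial.X (PlusGen.dnoise h)
    | .I a τ _ _ => -antipodeSum α κ i a (coactAntipode α κ i τ)

theorem size_add (k l : MI d) : MI.size (k + l) = k.size + l.size := by
  simp [MI.size, mul_add, Finset.sum_add_distrib]

theorem antipode_Xp (k : MI d) :
    antipode α κ i (Xp α κ i k) = (-1 : ℝ) ^ (∑ j, k j) • Xp α κ i k := by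
  have h : ∀ j : Fin (d + 1),
      antipode α κ i (MvPolynomial.X (PlusGen.X j) : Plus d α κ i) =
        (-1 : ℝ) • (MvPolynomial.X (PlusGen.X j) : Plus d α κ i) := fun j => by simp [antipode]
  simp only [Xp, map_prod, map_pow, h, smul_pow, Finset.prod_smul, Finset.prod_pow_eq_pow_sum]

theorem antipode_I_aux (a : MI d) (τ : Tree d) (hp : ¬ τ.IsPoly) (hd : 0 < degI α κ i a τ) :
    antipode α κ i (Ip α κ i a (tr τ)) = -antipodeSum α κ i a (coactAntipode α κ i τ) := by
  rw [Ip, extend_tr, dif_pos ⟨hp, hd⟩, antipode, MvPolynomial.aeval_X]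

/-- `coactAntipode` is `(id ⊗ 𝓐⁺_i) Δ_i`. -/
theorem coactAntipode_eq (τ : Tree d) :
    coactAntipode α κ i τ =
      Algebra.TensorProduct.map (AlgHom.id ℝ (Span d)) (antipode α κ i)
        (coact α κ i (tr τ)) := by
  have hdn : antipode α κ i (dnoisep α κ i : Plus d α κ i) = -dnoisep α κ i := by
    unfold dnoisep
    split_ifs with h
    · simp [antipode]
    · simp
  induction τ using Tree.induction with
  | hX k =>
    rw [coact_tr, treeCoact, coactAntipode, Tree.lift_X, Tree.lift_X]
    simp [antipode]
  | hn =>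
    rw [coact_tr, treeCoact, coactAntipode, Tree.lift_noise, Tree.lift_noise]
    simp
  | hd =>
    rw [coact_tr, treeCoact, coactAntipode, Tree.lift_dnoise, Tree.lift_dnoise]
    simp [hdn]
  | hm σ τ h1 h2 => rw [map_mul, h1, h2, tr_mul, map_mul, map_mul]
  | hp a τ hp ih =>
    have hI := fun b => antipode_I_aux α κ i b τ hp
    have hg : ∀ v : Span d ⊗[ℝ] Plus d α κ i,
        TensorProduct.map (graft a) LinearMap.id
          (Algebra.TensorProduct.map (AlgHom.id ℝ (Span d)) (antipode α κ i) v) =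
        Algebra.TensorProduct.map (AlgHom.id ℝ (Span d)) (antipode α κ i)
          (TensorProduct.map (graft a) LinearMap.id v) := fun v => by
      induction v using TensorProduct.induction_on with
      | zero => simp
      | tmul s p => simp
      | add s t h1 h2 => simp only [map_add, h1, h2]
    rw [coact_tr, treeCoact, Tree.lift_plant _ _ _ _ _ hp, ← treeCoact, map_add, ← hg, ← coact_tr,
      ← ih]
    conv_lhs => rw [coactAntipode, Tree.lift_plant _ _ _ _ _ hp, ← coactAntipode]
    congr 1
    simp only [map_sum]
    refine Finset.sum_congr rfl fun l _ => Finset.sum_congr rfl fun m hm => ?_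
    have hd : 0 < degI α κ i (a + l + m) τ := by
      have := mem_below.1 hm
      simp only [degI, size_add, Nat.cast_add] at this ⊢
      linarith
    rw [Algebra.TensorProduct.map_tmul, map_smul, map_smul, map_mul, hI _ hd, antipode_Xp]
    rfl

/-- The recursive formula for the antipode on planted trees:
`𝓐⁺(𝓘⁺_a(τ)) = - ∑_ℓ 𝓜 (𝓘⁺_{a+ℓ} ⊗ (X^ℓ / ℓ!) 𝓐⁺) Δ τ`. -/
theorem antipode_I (a : MI d) (τ : Tree d) (hp : ¬ τ.IsPoly) (hd : 0 < degI α κ i a τ) :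
    antipode α κ i (Ip α κ i a (tr τ)) =
      -antipodeSum α κ i a (Algebra.TensorProduct.map (AlgHom.id ℝ (Span d)) (antipode α κ i)
        (coact α κ i (tr τ))) := by
  rw [antipode_I_aux α κ i a τ hp hd, coactAntipode_eq]

/-- The linear map
`τ₁ ⊗ p ↦ ∑_{η ≤ |ℓ|_𝔰} (X^ℓ / ℓ!) ⊗ 𝓘^{+,i}_{a+ℓ}(τ₁) p` (summands with
`|ℓ|_𝔰 ≥ deg_i(𝓘_a(τ₁))` vanish, since then `𝓘^{+,i}_{a+ℓ}(τ₁) = 0`). -/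
def tailSum (η : ℝ) (a : MI d) :
    Span d ⊗[ℝ] Plus d α κ i →ₗ[ℝ] Span d ⊗[ℝ] Plus d α κ i :=
  TensorProduct.lift ((LinearMap.mul ℝ (Span d ⊗[ℝ] Plus d α κ i)).compl₁₂
    (extend fun τ => ∑ l ∈ (below d (degI α κ i a τ)).filter (fun l => η ≤ (l.size : ℝ)),
      ((l.fact : ℝ)⁻¹ • Xs l) ⊗ₜ Ip α κ i (a + l) (tr τ))
    (Algebra.TensorProduct.includeRight
      (R := ℝ) (A := Span d) (B := Plus d α κ i)).toLinearMap)

/-- The map `Δ̂_i` on trees. -/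
def treeHatDelta : Tree d →* Span d ⊗[ℝ] Plus d α κ i :=
  Tree.lift
    (fun j => Xs (Pi.single j 1) ⊗ₜ 1)
    (tr Tree.noise ⊗ₜ 1)
    (tr Tree.dnoise ⊗ₜ 1 - 1 ⊗ₜ dnoisep α κ i)
    (fun a τ v => TensorProduct.map (graft a) LinearMap.id v -
      tailSum α κ i (degI α κ 0 a τ) a v)

/-- The map `Δ̂_i : 𝓣 → 𝓣 ⊗ 𝓣^{+,i}` (used for `i = 1, 2`). -/
def hatDelta : Span d →ₐ[ℝ] Span d ⊗[ℝ] Plus d α κ i :=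
  MonoidAlgebra.lift ℝ _ _ (treeHatDelta α κ i)

end Hopf

/-! ### Preparation maps -/

/-- A preparation map `R : 𝓣 → 𝓣`. -/
structure PreparationMap (d : ℕ) (α κ : ℝ) where
  /-- The underlying linear map. -/
  toLin : Span d →ₗ[ℝ] Span d
  map_X : ∀ k : MI d, toLin (Xs k) = Xs k
  map_noise : toLin (tr Tree.noise) = tr Tree.noise
  map_dnoise : toLin (tr Tree.dnoise) = tr Tree.dnoise
  map_graft : ∀ (a : MI d) (τ : Tree d), toLin (graft a (tr τ)) = graft a (tr τ)
  triangular : ∀ τ : Tree d, ∀ σ ∈ (toLin (tr τ) - tr τ).coeff.support,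
    deg α κ 0 τ ≤ deg α κ 0 σ ∧ σ.noiseCount < τ.noiseCount
  coact_comm : ∀ (i : Fin 3) (v : Span d),
    TensorProduct.map toLin LinearMap.id (coact α κ i v) = coact α κ i (toLin v)
  DXi_comm : ∀ v ∈ Span0 d, toLin (DXi v) = DXi (toLin v)

/-! ### The renormalised model -/

section Model

variable {d : ℕ}

/-- The partial derivative `∂_j f`. -/
def partialDeriv (j : Fin (d + 1)) (f : Pt d → ℝ) : Pt d → ℝ :=
  fun y => fderiv ℝ f y (Pi.single j 1)

/-- The iterated partial derivative `∂^a f`. -/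
def mderiv (a : MI d) (f : Pt d → ℝ) : Pt d → ℝ :=
  (List.finRange (d + 1)).foldr (fun j h => (partialDeriv j)^[a j] h) f

/-- `∂^a K * f`, i.e. `∂^a (K * f)` (the kernel is differentiated as a distribution). -/
def conv (K : Pt d → ℝ) (a : MI d) (f : Pt d → ℝ) : Pt d → ℝ :=
  mderiv a (MeasureTheory.convolution K f (ContinuousLinearMap.mul ℝ ℝ) MeasureTheory.volume)

/-- The monomial function `z ↦ z^k`. -/
def mpow (z : Pt d) (k : MI d) : ℝ := ∏ j, z j ^ k j

variable (α κ : ℝ) (R : PreparationMap d α κ) (K ξ δξ : Pt d → ℝ) (i : Fin 3) (x : Pt d)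

/-- The recentred convolution
`y ↦ (∂^a K * f)(y) - ∑_{|k|_𝔰 < c} (y - x)^k / k! (∂^{a+k} K * f)(x)`. -/
def recenter (K : Pt d → ℝ) (x : Pt d) (a : MI d) (c : ℝ) (f : Pt d → ℝ) : Pt d → ℝ :=
  fun y => conv K a f y - ∑ k ∈ below d c, mpow (y - x) k / (k.fact : ℝ) * conv K (a + k) f x

/-- Auxiliary for `modelTimes`: the value on trees with at most `n` noises.  The recursion uses
`Π τ = Π^× R τ = Π^× τ + Π^× (R τ - τ)`, where `R τ - τ` has fewer noises than `τ`. -/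
def modelAux : ℕ → Tree d →* (Pt d → ℝ)
  | 0 => Tree.lift (fun j y => y j - x j) ξ (fun y => if i = 2 then δξ y - δξ x else δξ y)
      (fun a τ v => recenter K x a (degI α κ i a τ) v)
  | n + 1 => Tree.lift (fun j y => y j - x j) ξ (fun y => if i = 2 then δξ y - δξ x else δξ y)
      (fun a τ v => recenter K x a (degI α κ i a τ)
        (v + extend (modelAux n) (R.toLin (tr τ) - tr τ)))

/-- The map `Π^{i,×}_x`. -/
def modelTimes : Span d →ₗ[ℝ] (Pt d → ℝ) :=
  extend fun τ => modelAux α κ R K ξ δξ i x τ.noiseCount τ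

theorem noiseCount_mul (σ τ : Tree d) : (σ * τ).noiseCount = σ.noiseCount + τ.noiseCount := by
  simp [Tree.noiseCount]

theorem noiseCount_plant (a : MI d) {τ : Tree d} (h : ¬ τ.IsPoly) :
    (τ.plant a).noiseCount = τ.noiseCount := by
  rw [Tree.noiseCount, Tree.lift_plant _ _ _ _ _ h, Tree.noiseCount]

theorem extend_congr {V : Type*} [AddCommGroup V] [Module ℝ V] {f g : Tree d → V} {v : Span d}
    (h : ∀ σ ∈ v.coeff.support, f σ = g σ) : extend f v = extend g v := by
  change Finsupp.linearCombination ℝ f v.coeff = Finsupp.linearCombination ℝ g v.coeff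
  simp only [Finsupp.linearCombination_apply, Finsupp.sum]
  exact Finset.sum_congr rfl fun σ hσ => by rw [h σ hσ]

theorem modelAux_of_le (n : ℕ) (τ : Tree d) (h : τ.noiseCount ≤ n) :
    modelAux α κ R K ξ δξ i x n τ = modelAux α κ R K ξ δξ i x τ.noiseCount τ := by
  have main : ∀ (m n : ℕ), (∀ m' < m, ∀ n' ≥ m', ∀ σ : Tree d, σ.noiseCount ≤ m' →
      modelAux α κ R K ξ δξ i x n' σ = modelAux α κ R K ξ δξ i x m' σ) → m ≤ n →
      ∀ τ : Tree d, τ.noiseCount ≤ m →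
      modelAux α κ R K ξ δξ i x n τ = modelAux α κ R K ξ δξ i x m τ := by
    intro m n H hmn τ
    induction τ using Tree.induction with
    | hX k => intro _; cases m <;> cases n <;> rfl
    | hn => intro _; cases m <;> cases n <;> rfl
    | hd => intro _; cases m <;> cases n <;> rfl
    | hm σ τ h1 h2 =>
      intro hle
      rw [noiseCount_mul] at hle
      rw [map_mul, map_mul, h1 (by omega), h2 (by omega)]
    | hp a τ hp ih =>
      intro hle
      rw [noiseCount_plant a hp] at hle
      have ih := ih hle
      have tri := R.triangular τ
      cases n with
      | zero =>
        obtain rfl : m = 0 := by omega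
        rfl
      | succ n =>
        cases m with
        | zero =>
          have h0 : R.toLin (tr τ) - tr τ = 0 := by
            have : (R.toLin (tr τ) - tr τ).coeff.support = ∅ :=
              Finset.eq_empty_of_forall_notMem fun σ hσ => by have := (tri σ hσ).2; omega
            rw [Finsupp.support_eq_empty] at this
            exact MonoidAlgebra.coeff_injective this
          simp only [modelAux, Tree.lift_plant _ _ _ _ _ hp] at ih ⊢
          rw [h0, map_zero, add_zero, ih]
        | succ m =>
          have h1 : extend (modelAux α κ R K ξ δξ i x n) (R.toLin (tr τ) - tr τ) =
              extend (modelAux α κ R K ξ δξ i x m) (R.toLin (tr τ) - tr τ) :=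
            extend_congr fun σ hσ =>
              H m (by omega) n (by omega) σ (by have := (tri σ hσ).2; omega)
          simp only [modelAux, Tree.lift_plant _ _ _ _ _ hp] at ih ⊢
          rw [ih, h1]
  have all : ∀ m n : ℕ, m ≤ n → ∀ τ : Tree d, τ.noiseCount ≤ m →
      modelAux α κ R K ξ δξ i x n τ = modelAux α κ R K ξ δξ i x m τ := by
    intro m
    induction m using Nat.strong_induction_on with
    | _ m IH => exact fun n hmn => main m n (fun m' hm' n' hn' => IH m' hm' n' hn') hmn
  exact all _ _ h τ le_rfl

/-- The renormalised model `Π^i_x = Π^{i,×}_x R`. -/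
def model : Span d →ₗ[ℝ] (Pt d → ℝ) := modelTimes α κ R K ξ δξ i x ∘ₗ R.toLin

/-- `Π^{i,×}_x X^k = (· - x)^k`. -/
theorem modelTimes_X (k : MI d) :
    modelTimes α κ R K ξ δξ i x (Xs k) = fun y => mpow (y - x) k := by
  rw [modelTimes, Xs, extend_tr]
  have h : ∀ n, modelAux α κ R K ξ δξ i x n (Tree.X k) = fun y => mpow (y - x) k := by
    intro n
    cases n <;> simp only [modelAux, Tree.lift_X] <;> ext y <;> simp [mpow]
  exact h _

/-- `Π^{i,×}_x Ξ = ξ`. -/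
theorem modelTimes_noise : modelTimes α κ R K ξ δξ i x (tr Tree.noise) = ξ := by
  rw [modelTimes, extend_tr]; rfl

/-- `Π^{i,×}_x Ξ̇` is `δξ` for `i ≠ 2` and `δξ - δξ(x)` for `i = 2`. -/
theorem modelTimes_dnoise : modelTimes α κ R K ξ δξ i x (tr Tree.dnoise) =
    fun y => if i = 2 then δξ y - δξ x else δξ y := by
  rw [modelTimes, extend_tr]; rfl

/-- `Π^{i,×}_x` is multiplicative. -/
theorem modelTimes_mul (σ τ : Tree d) : modelTimes α κ R K ξ δξ i x (tr (σ * τ)) =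
    modelTimes α κ R K ξ δξ i x (tr σ) * modelTimes α κ R K ξ δξ i x (tr τ) := by
  simp only [modelTimes, extend_tr]
  rw [map_mul, noiseCount_mul,
    modelAux_of_le α κ R K ξ δξ i x _ σ (Nat.le_add_right _ _),
    modelAux_of_le α κ R K ξ δξ i x _ τ (Nat.le_add_left _ _)]

/-- The recursive definition of `Π^{i,×}_x` on planted trees. -/
theorem modelTimes_plant (a : MI d) {τ : Tree d} (hp : ¬ τ.IsPoly) :
    modelTimes α κ R K ξ δξ i x (tr (τ.plant a)) =
      recenter K x a (degI α κ i a τ) (model α κ R K ξ δξ i x (tr τ)) := by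
  have hm : model α κ R K ξ δξ i x (tr τ) = modelTimes α κ R K ξ δξ i x (tr τ) +
      modelTimes α κ R K ξ δξ i x (R.toLin (tr τ) - tr τ) := by
    simp [model]
  have tri := R.triangular τ
  rw [hm]
  simp only [modelTimes, extend_tr]
  rw [noiseCount_plant a hp]
  rcases hn : τ.noiseCount with _ | n
  · have h0 : R.toLin (tr τ) - tr τ = 0 := by
      have : (R.toLin (tr τ) - tr τ).coeff.support = ∅ :=
        Finset.eq_empty_of_forall_notMem fun σ hσ => by have := (tri σ hσ).2; omega
      rw [Finsupp.support_eq_empty] at this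
      exact MonoidAlgebra.coeff_injective this
    rw [h0, map_zero, add_zero]
    simp only [modelAux, Tree.lift_plant _ _ _ _ _ hp]
  · have h1 : extend (fun σ => modelAux α κ R K ξ δξ i x σ.noiseCount σ)
        (R.toLin (tr τ) - tr τ) =
        extend (modelAux α κ R K ξ δξ i x n) (R.toLin (tr τ) - tr τ) :=
      extend_congr fun σ hσ =>
        (modelAux_of_le α κ R K ξ δξ i x n σ (by have := (tri σ hσ).2; omega)).symm
    rw [h1]
    simp only [modelAux, Tree.lift_plant _ _ _ _ _ hp]

/-- The linear map `𝓙^i_a(x)`. -/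
def J (a : MI d) : Span d →ₗ[ℝ] Span d :=
  extend fun τ => ∑ k ∈ below d (degI α κ i a τ),
    (conv K (a + k) (model α κ R K ξ δξ i x (tr τ)) x / (k.fact : ℝ)) • Xs k

/-- The character `f^i_x` of `𝓣^{+,i}`. -/
def char : Plus d α κ i →ₐ[ℝ] ℝ :=
  MvPolynomial.aeval fun q => match q with
    | .X j => -x j
    | .dnoise _ => -δξ x
    | .I a τ _ _ => -conv K a (model α κ R K ξ δξ i x (tr τ)) x

/-- The character `γ^i_{xy} = (f^i_x 𝓐⁺_i ⊗ f^i_y) Δ⁺_i`. -/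
def gam (x y : Pt d) : Plus d α κ i →ₐ[ℝ] ℝ :=
  (Algebra.TensorProduct.lmul' ℝ).comp
    ((Algebra.TensorProduct.map ((char α κ R K ξ δξ i x).comp (antipode α κ i))
      (char α κ R K ξ δξ i y)).comp (coprod α κ i))

/-- The re-expansion map `Γ^i_{xy} = (id ⊗ γ^i_{xy}) Δ_i`. -/
def Gam (x y : Pt d) : Span d →ₐ[ℝ] Span d :=
  (Algebra.TensorProduct.rid ℝ ℝ (Span d)).toAlgHom.comp
    ((Algebra.TensorProduct.map (AlgHom.id ℝ (Span d)) (gam α κ R K ξ δξ i x y)).comp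
      (coact α κ i))

/-- The map `∂Γ²_{yx} = (Γ²_{yx} ⊗ f²_x) Δ̂_2 D_Ξ`. -/
def dGam (y x : Pt d) : Span d →ₗ[ℝ] Span d :=
  (TensorProduct.rid ℝ (Span d)).toLinearMap ∘ₗ
    TensorProduct.map (Gam α κ R K ξ δξ 2 y x).toLinearMap
      (char α κ R K ξ δξ 2 x).toLinearMap ∘ₗ
    (hatDelta α κ 2).toLinearMap ∘ₗ DXi

end Model

end DecTree

end

/-! Everything is reduced to the action of characters. For a character `g` of the plus algebra, `act
g` is $(\mathrm{id}\otimes g)\Delta_2$, and the numbers $g(\mathcal I^+_{a+l}(u))$ enter only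
through the Taylor sums $T_g(z;a,u)=\sum_l \frac{z^l}{l!}\,g(\mathcal I^+_{a+l}(u))$, called
`taylorI`. The degree-dependent truncations in the definitions can all be replaced by one large
cut-off `N`, because $\mathcal I^+_b(\tau)$ vanishes once its degree is not positive. With a common
cut-off, iterated Taylor sums obey the binomial rule `taylor_taylor`, so nested sums collapse and
only their base points have to be tracked.

Evaluated in this way, the recursions become: `act g` sends $\mathcal I_a u$ to $\mathcal
I_a(\mathrm{act}_g u)+T_g(X+g(X);a,u)$, and there are similar one-line formulas for the antipode and
the coproduct. Hence $\Gamma_{yx}$ is the composition of the actions of $f_y\mathcal A^+$ and $f_x$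
(`act_transition`), $\Gamma_{xx}=\mathrm{id}$, and $\Gamma_{yx}$ carries $\mathcal I_a
u-T_{f_x}(X;a,u)$ to $\mathcal I_a v-T_{f_y}(X;a,v)$ with $v=\Gamma_{yx}u$ (`act_transition_graft`).
These identities are proved by induction on trees and linear extension.

For $\hat\Delta_2$, put $v=(\mathrm{id}\otimes f_x)\hat\Delta_2D_\Xi\tau$. All trees in $D_\Xi\tau$
share the same `deg 0`, so the subtracted tail is $T_{f_x}(X;a,v)$ minus its projection by a single
$P_\eta$, $\eta=\deg_0\mathcal I_a\tau$ (`hatAct_graft`). Applying $\Gamma_{yx}$ turns $\mathcal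
I_av-T_{f_x}(X;a,v)$ into the same expression at $y$, and leaves $\Gamma_{yx}P_\eta T_{f_x}(X;a,v)$
as the correction.

It remains to identify $-T_{f_x}(X;a,\cdot)$ with $\mathcal J_a(x)$. On non-monomial trees this is
the definition of $f_x$. On $X^k$ the former is zero by convention, and the latter is zero by the
moment condition if $|k|_{\mathfrak s}<r$ (`J_eq_neg_taylorI`). This is why the strict bound on
monomials in `degLE'` is propagated through every map. The product rule holds because
$(\mathrm{id}\otimes f_x)\hat\Delta_2$ is multiplicative and fixes trees without $\dot\Xi$. -/

namespace DecTree

/-! ### Truncated Taylor sums -/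

section Taylor

variable {d : ℕ} {A B : Type*} [CommRing A] [Algebra ℝ A] [CommRing B] [Algebra ℝ B]

/-- The power `z^k` of a vector in a commutative algebra. -/
def vpow (z : Fin (d + 1) → B) (k : MI d) : B := ∏ j, z j ^ k j

/-- The truncated Taylor sum `∑_{|l|_𝔰 < N} z^l / l! c(a+l)`. -/
noncomputable def taylor (N : ℝ) (z : Fin (d + 1) → B) (c : MI d → B) (a : MI d) : B :=
  ∑ l ∈ below d N, (l.fact : ℝ)⁻¹ • (vpow z l * c (a + l))

theorem map_vpow (φ : A →ₐ[ℝ] B) (z : Fin (d + 1) → A) (k : MI d) :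
    φ (vpow z k) = vpow (fun j => φ (z j)) k := by
  simp [vpow]

theorem map_taylor (φ : A →ₐ[ℝ] B) (N : ℝ) (z : Fin (d + 1) → A) (c : MI d → A) (a : MI d) :
    φ (taylor N z c a) = taylor N (fun j => φ (z j)) (fun b => φ (c b)) a := by
  simp [taylor, map_vpow]

theorem taylor_add (N : ℝ) (z : Fin (d + 1) → B) (c c' : MI d → B) (a : MI d) :
    taylor N z (fun b => c b + c' b) a = taylor N z c a + taylor N z c' a := by
  simp [taylor, mul_add, Finset.sum_add_distrib]

theorem taylor_neg (N : ℝ) (z : Fin (d + 1) → B) (c : MI d → B) (a : MI d) :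
    taylor N z (fun b => -c b) a = -taylor N z c a := by
  simp [taylor]

/-- The binomial theorem in divided-power form, coordinate by coordinate; the product of the
one-variable sums expands over the box of all multi-indices below `p`. -/
theorem vpow_add_fact (z w : Fin (d + 1) → B) (p : MI d) :
    (p.fact : ℝ)⁻¹ • vpow (z + w) p =
      ∑ l ∈ Finset.Iic p, ((l.fact : ℝ)⁻¹ * ((p - l).fact : ℝ)⁻¹) • (vpow z l * vpow w (p - l)) := by
  have h1 : ∀ j, ((p j).factorial : ℝ)⁻¹ • (z j + w j) ^ p j =
      ∑ m ∈ Finset.Iic (p j), ((m.factorial : ℝ)⁻¹ * ((p j - m).factorial : ℝ)⁻¹) •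
        (z j ^ m * w j ^ (p j - m)) := fun j => by
    rw [add_pow, Finset.smul_sum, Nat.range_succ_eq_Iic]
    refine Finset.sum_congr rfl fun m hm => ?_
    have hm' : m ≤ p j := Finset.mem_Iic.1 hm
    rw [mul_comm, ← nsmul_eq_mul, ← Nat.cast_smul_eq_nsmul ℝ, smul_smul, Nat.cast_choose ℝ hm']
    congr 1
    have := Nat.factorial_ne_zero (p j)
    field_simp
  have h2 : (p.fact : ℝ)⁻¹ • vpow (z + w) p =
      ∏ j, (((p j).factorial : ℝ)⁻¹ • (z j + w j) ^ p j) := by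
    rw [Finset.prod_smul]
    simp [MI.fact, vpow]
  have h3 : Finset.Iic p = Fintype.piFinset fun j => Finset.Iic (p j) := by
    ext l; simp [Pi.le_def]
  rw [h2, Finset.prod_congr rfl fun j _ => h1 j, Finset.prod_univ_sum, h3]
  refine Finset.sum_congr rfl fun l _ => ?_
  rw [Finset.prod_smul, Finset.prod_mul_distrib]
  simp [MI.fact, vpow, Finset.prod_mul_distrib]

/-- Regroup the double sum by $p=l+m$ and use the binomial theorem. The square of pairs $(l,m)$ is
larger than the triangle $l\le p$, $|p|_{\mathfrak s}<N$, but the excess pairs carry vanishing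
coefficients. This lets every later argument ignore truncations. -/
theorem taylor_taylor {N : ℝ} (z w : Fin (d + 1) → B) {c : MI d → B}
    (hc : ∀ b : MI d, N ≤ (b.size : ℝ) → c b = 0) (a : MI d) :
    taylor N z (taylor N w c) a = taylor N (z + w) c a := by
  have hR : taylor N (z + w) c a = ∑ q ∈ (below d N).sigma (fun p => Finset.Iic p),
      ((q.2.fact : ℝ)⁻¹ * ((q.1 - q.2).fact : ℝ)⁻¹) •
        (vpow z q.2 * vpow w (q.1 - q.2) * c (a + q.1)) := by
    rw [taylor, Finset.sum_sigma]
    refine Finset.sum_congr rfl fun p _ => ?_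
    rw [← smul_mul_assoc, vpow_add_fact, Finset.sum_mul]
    simp
  have hL : taylor N z (taylor N w c) a = ∑ q ∈ (below d N) ×ˢ (below d N),
      ((q.1.fact : ℝ)⁻¹ * (q.2.fact : ℝ)⁻¹) •
        (vpow z q.1 * vpow w q.2 * c (a + (q.1 + q.2))) := by
    rw [taylor, Finset.sum_product]
    refine Finset.sum_congr rfl fun l _ => ?_
    rw [taylor, Finset.mul_sum, Finset.smul_sum]
    refine Finset.sum_congr rfl fun m _ => ?_
    rw [mul_smul_comm, smul_smul, mul_assoc, add_assoc]
  rw [hL, hR]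
  symm
  -- The triangle embeds into the square by $(p,l)\mapsto(l,p-l)$.
  refine Finset.sum_of_injOn (fun q => (q.2, q.1 - q.2)) ?_ ?_ ?_ ?_
  · rintro ⟨p, l⟩ h ⟨p', l'⟩ h' heq
    simp only [Finset.coe_sigma, Set.mem_sigma_iff, Finset.mem_coe, Finset.mem_Iic] at h h'
    simp only [Prod.mk.injEq] at heq
    obtain ⟨rfl, h2⟩ := heq
    have : p = p' := by rw [← tsub_add_cancel_of_le h.2, h2, tsub_add_cancel_of_le h'.2]
    subst this; rfl
  · rintro ⟨p, l⟩ h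
    simp only [Finset.coe_sigma, Set.mem_sigma_iff, Finset.mem_coe, Finset.mem_Iic,
      mem_below] at h
    have : (p.size : ℝ) = l.size + (p - l).size := by
      rw [← Nat.cast_add, ← size_add, add_tsub_cancel_of_le h.2]
    simp only [Finset.coe_product, Set.mem_prod, Finset.mem_coe, mem_below]
    constructor <;> [have := Nat.cast_nonneg (α := ℝ) (p - l).size;
      have := Nat.cast_nonneg (α := ℝ) l.size] <;> linarith
  -- A pair outside the image has $|l+m|_{\mathfrak s}\ge N$, so its coefficient is zero by `hc`.
  · rintro ⟨l, m⟩ _ hn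
    rw [hc, mul_zero, smul_zero]
    by_contra hlt
    refine hn ⟨⟨l + m, l⟩, ?_, by simp⟩
    simp only [Finset.coe_sigma, Set.mem_sigma_iff, Finset.mem_coe, Finset.mem_Iic, mem_below]
    refine ⟨?_, le_self_add⟩
    simp only [size_add, Nat.cast_add] at hlt ⊢
    have := Nat.cast_nonneg (α := ℝ) a.size
    linarith
  · rintro ⟨p, l⟩ h
    simp only [Finset.mem_sigma, Finset.mem_Iic] at h
    simp only [add_tsub_cancel_of_le h.2]

/-- The truncation may be lowered to any threshold beyond which the coefficients vanish. -/
theorem sum_below_eq_taylor {M N : ℝ} (hMN : M ≤ N) (z : Fin (d + 1) → B) {c : MI d → B}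
    {a : MI d} (hc : ∀ l : MI d, M ≤ (l.size : ℝ) → c (a + l) = 0) :
    ∑ l ∈ below d M, (l.fact : ℝ)⁻¹ • (vpow z l * c (a + l)) = taylor N z c a := by
  refine Finset.sum_subset (fun l hl => mem_below.2 ((mem_below.1 hl).trans_le hMN))
    fun l _ hl => ?_
  rw [hc l (by simpa using hl), mul_zero, smul_zero]

end Taylor

/-! ### Degrees and spans of trees -/

section Spans

variable {d : ℕ} (α κ : ℝ)

theorem deg_mul (i : Fin 3) (σ τ : Tree d) : deg α κ i (σ * τ) = deg α κ i σ + deg α κ i τ := by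
  simp [deg]

theorem deg_X (i : Fin 3) (k : MI d) : deg α κ i (Tree.X k) = k.size := by
  rw [deg, Tree.lift_X]
  simp [MI.size, mul_comm]

theorem deg_one (i : Fin 3) : deg α κ i (1 : Tree d) = 0 := by simp [deg]

theorem deg_noise (i : Fin 3) : deg α κ i (Tree.noise : Tree d) = α := rfl

theorem deg_dnoise (i : Fin 3) : deg α κ i (Tree.dnoise : Tree d) = degDnoise d α κ i := rfl

theorem deg_plant (i : Fin 3) (a : MI d) {τ : Tree d} (h : ¬ τ.IsPoly) :
    deg α κ i (τ.plant a) = degI α κ i a τ := by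
  rw [deg, Tree.lift_plant _ _ _ _ _ h, degI, deg]; rfl

theorem Tree.isPoly_X (k : MI d) : (Tree.X k).IsPoly := ⟨k, rfl⟩

theorem Tree.not_isPoly_noise : ¬ (Tree.noise : Tree d).IsPoly := by
  simp [Tree.noise, Tree.isPoly_mk]

theorem Tree.not_isPoly_dnoise : ¬ (Tree.dnoise : Tree d).IsPoly := by
  simp [Tree.dnoise, Tree.isPoly_mk]

theorem Tree.not_isPoly_plant (a : MI d) {τ : Tree d} (h : ¬ τ.IsPoly) :
    ¬ (τ.plant a).IsPoly := by
  induction τ using Quotient.inductionOn with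
  | h p =>
    obtain ⟨b, t⟩ := p
    cases b
    · exact fun h => by simpa using (Tree.isPoly_mk (Pre.plant a t)).1 h
    · exact absurd (Tree.isPoly_of_true t rfl) h

theorem Tree.isPoly_mul {σ τ : Tree d} : (σ * τ).IsPoly ↔ σ.IsPoly ∧ τ.IsPoly := by
  induction σ using Quotient.inductionOn with
  | h p =>
    induction τ using Quotient.inductionOn with
    | h q =>
      refine (Tree.isPoly_mk (Pre.mul p.2 q.2)).trans ?_
      rw [Bool.and_eq_true]
      exact and_congr (Tree.isPoly_mk p.2).symm (Tree.isPoly_mk q.2).symm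

/-- The linear span of the trees satisfying a predicate. -/
noncomputable def spanOn (p : Tree d → Prop) : Submodule ℝ (Span d) := Submodule.span ℝ (tr '' {τ | p τ})

theorem tr_mem_spanOn {p : Tree d → Prop} {τ : Tree d} (h : p τ) : tr τ ∈ spanOn p :=
  Submodule.subset_span ⟨τ, h, rfl⟩

theorem map_mem_of_mem_spanOn {V : Type*} [AddCommGroup V] [Module ℝ V] {S : Submodule ℝ V}
    {p : Tree d → Prop} (f : Span d →ₗ[ℝ] V) (h : ∀ τ, p τ → f (tr τ) ∈ S) {u : Span d}
    (hu : u ∈ spanOn p) : f u ∈ S := by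
  have : spanOn p ≤ S.comap f := Submodule.span_le.2 (by rintro _ ⟨τ, hτ, rfl⟩; exact h τ hτ)
  exact this hu

theorem eq_of_mem_spanOn {V : Type*} [AddCommGroup V] [Module ℝ V]
    {p : Tree d → Prop} (f g : Span d →ₗ[ℝ] V) (h : ∀ τ, p τ → f (tr τ) = g (tr τ)) {u : Span d}
    (hu : u ∈ spanOn p) : f u = g u := by
  have := map_mem_of_mem_spanOn (S := ⊥) (f - g) (fun τ hτ => by simp [h τ hτ]) hu
  simpa [sub_eq_zero] using this

theorem spanOn_mono {p q : Tree d → Prop} (h : ∀ τ, p τ → q τ) {u : Span d}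
    (hu : u ∈ spanOn p) : u ∈ spanOn q :=
  map_mem_of_mem_spanOn LinearMap.id (fun _ hτ => tr_mem_spanOn (h _ hτ)) hu

theorem mul_mem_spanOn {p q s : Tree d → Prop} (h : ∀ σ τ, p σ → q τ → s (σ * τ))
    {u v : Span d} (hu : u ∈ spanOn p) (hv : v ∈ spanOn q) : u * v ∈ spanOn s :=
  map_mem_of_mem_spanOn (LinearMap.mulRight ℝ v) (fun σ hσ =>
    map_mem_of_mem_spanOn (LinearMap.mulLeft ℝ (tr σ)) (fun τ hτ => by
      rw [LinearMap.mulLeft_apply, ← tr_mul]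
      exact tr_mem_spanOn (h σ τ hσ hτ)) hv) hu

theorem mem_spanOn_true (u : Span d) : u ∈ spanOn (fun _ : Tree d => True) := by
  induction u using MonoidAlgebra.induction_linear with
  | zero => exact zero_mem _
  | add u v hu hv => exact add_mem hu hv
  | single τ c =>
    have : MonoidAlgebra.single τ c = c • tr τ := by
      simp [tr, MonoidAlgebra.of_apply]
    rw [this]
    exact Submodule.smul_mem _ _ (tr_mem_spanOn trivial)

theorem tr_one : tr (1 : Tree d) = 1 := map_one _

theorem Xs_eq_vpow (k : MI d) :
    Xs k = vpow (fun j => (Xs (Pi.single j 1) : Span d)) k := by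
  have h1 : ∀ m : ℕ, ∀ l : MI d, Xs l ^ m = Xs (m • l) := fun m l => by
    induction m with
    | zero => simp [Xs, Tree.X_zero, tr_one]
    | succ m ih => rw [pow_succ, ih, Xs, Xs, ← tr_mul, ← Tree.X_add, succ_nsmul, Xs]
  have h2 : ∀ (s : Finset (Fin (d + 1))) (f : Fin (d + 1) → MI d),
      ∏ j ∈ s, (Xs (f j) : Span d) = Xs (∑ j ∈ s, f j) := fun s f => by
    induction s using Finset.cons_induction with
    | empty => simp [Xs, Tree.X_zero, tr_one]
    | cons j s hj ih => rw [Finset.prod_cons, Finset.sum_cons, ih, Xs, Xs, ← tr_mul, ← Tree.X_add, Xs]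
  simp only [vpow, h1, h2]
  congr 1
  ext j
  simp [Finset.sum_apply, Pi.single_apply]

theorem graft_tr_of_not_isPoly (a : MI d) {τ : Tree d} (h : ¬ τ.IsPoly) :
    graft a (tr τ) = tr (τ.plant a) := by
  rw [graft, extend_tr, if_neg h]

theorem graft_tr_of_isPoly (a : MI d) {τ : Tree d} (h : τ.IsPoly) : graft a (tr τ) = 0 := by
  rw [graft, extend_tr, if_pos h]

theorem Ip_tr_eq_zero (i : Fin 3) (a : MI d) {τ : Tree d} (h : τ.IsPoly ∨ degI α κ i a τ ≤ 0) :
    Ip α κ i a (tr τ) = 0 := by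
  rw [Ip, extend_tr, dif_neg]
  rintro ⟨h1, h2⟩
  rcases h with h | h
  · exact h1 h
  · exact absurd h2 h.not_gt

/-- The span of the trees `τ` with `deg_2 τ ≤ D`. -/
noncomputable abbrev degLE (d : ℕ) (α κ D : ℝ) : Submodule ℝ (Span d) := spanOn fun τ : Tree d => deg α κ 2 τ ≤ D

/-- The span of the monomials `X^k` with `|k|_𝔰 < D` and the other trees `τ` with `deg_2 τ ≤ D`. -/
noncomputable abbrev degLE' (d : ℕ) (α κ D : ℝ) : Submodule ℝ (Span d) :=
  spanOn fun τ : Tree d => deg α κ 2 τ ≤ D ∧ (τ.IsPoly → deg α κ 2 τ < D)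

variable {α κ}

/-- Trees of degree at most `D` give $\mathcal I_b$ a nonpositive degree here. This is what makes
any cut-off $N\ge D+2$ harmless. -/
theorem Ip_eq_zero_of_mem_degLE {D : ℝ} {u : Span d} (hu : u ∈ degLE d α κ D) {b : MI d}
    (hb : D + 2 ≤ b.size) : Ip α κ 2 b u = 0 :=
  eq_of_mem_spanOn (Ip α κ 2 b) 0 (fun τ hτ => by
    rw [Ip_tr_eq_zero α κ 2 b (Or.inr (by unfold degI; linarith)), LinearMap.zero_apply]) hu

theorem Ip_eq_zero_of_isPoly {u : Span d} (hu : u ∈ spanOn (Tree.IsPoly (d := d))) (b : MI d) :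
    Ip α κ 2 b u = 0 :=
  eq_of_mem_spanOn (Ip α κ 2 b) 0 (fun τ hτ => by
    rw [Ip_tr_eq_zero α κ 2 b (Or.inl hτ), LinearMap.zero_apply]) hu

theorem graft_eq_zero_of_isPoly {u : Span d} (hu : u ∈ spanOn (Tree.IsPoly (d := d))) (b : MI d) :
    graft b u = 0 :=
  eq_of_mem_spanOn (graft b) 0 (fun τ hτ => by
    rw [graft_tr_of_isPoly b hτ, LinearMap.zero_apply]) hu

/-- Planted trees are never monomials, so the strict clause of `degLE'` is vacuous for them. -/
theorem graft_mem_degLE' {D : ℝ} {u : Span d} (hu : u ∈ degLE d α κ D) (a : MI d) :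
    graft a u ∈ degLE' d α κ (D + 2 - a.size) :=
  map_mem_of_mem_spanOn (graft a) (fun τ hτ => by
    by_cases h : τ.IsPoly
    · rw [graft_tr_of_isPoly a h]; exact zero_mem _
    · rw [graft_tr_of_not_isPoly a h]
      refine tr_mem_spanOn ⟨?_, fun h' => absurd h' (Tree.not_isPoly_plant a h)⟩
      rw [deg_plant α κ 2 a h, degI]
      linarith) hu

theorem Xs_mem_degLE' {D : ℝ} {k : MI d} (h : (k.size : ℝ) < D) : Xs k ∈ degLE' d α κ D :=
  tr_mem_spanOn ⟨by rw [deg_X]; exact h.le, fun _ => by rw [deg_X]; exact h⟩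

theorem degLE'_le {D : ℝ} {u : Span d} (hu : u ∈ degLE' d α κ D) : u ∈ degLE d α κ D :=
  spanOn_mono (fun _ h => h.1) hu

end Spans

/-! ### The action of a character -/

section Act

variable {d : ℕ} {α κ : ℝ}

/-- The map `id ⊗ g`, for a character `g`. -/
noncomputable def slice (g : Plus d α κ 2 →ₐ[ℝ] ℝ) : Span d ⊗[ℝ] Plus d α κ 2 →ₐ[ℝ] Span d :=
  (Algebra.TensorProduct.rid ℝ ℝ (Span d)).toAlgHom.comp
    (Algebra.TensorProduct.map (AlgHom.id ℝ (Span d)) g)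

/-- The action `(id ⊗ g) Δ_2` of a character `g`. -/
noncomputable def act (g : Plus d α κ 2 →ₐ[ℝ] ℝ) : Span d →ₐ[ℝ] Span d :=
  (slice g).comp (coact α κ 2)

theorem slice_tmul (g : Plus d α κ 2 →ₐ[ℝ] ℝ) (u : Span d) (p : Plus d α κ 2) :
    slice g (u ⊗ₜ p) = g p • u := by
  simp [slice]

theorem slice_graft (g : Plus d α κ 2 →ₐ[ℝ] ℝ) (a : MI d) (w : Span d ⊗[ℝ] Plus d α κ 2) :
    slice g (TensorProduct.map (graft a) LinearMap.id w) = graft a (slice g w) := by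
  induction w using TensorProduct.induction_on with
  | zero => simp
  | tmul u p => simp [slice_tmul]
  | add s t hs ht => simp only [map_add, hs, ht]

theorem act_tr (g : Plus d α κ 2 →ₐ[ℝ] ℝ) (τ : Tree d) :
    act g (tr τ) = slice g (treeCoact α κ 2 τ) := by
  rw [act, AlgHom.comp_apply, coact_tr]

/-- The values of a character at the `X_j`. -/
noncomputable def onX (g : Plus d α κ 2 →ₐ[ℝ] ℝ) (j : Fin (d + 1)) : ℝ :=
  g (MvPolynomial.X (PlusGen.X j))

/-- The vector `(X_0,…,X_d)`. -/
noncomputable def Xv (j : Fin (d + 1)) : Span d := Xs (Pi.single j 1)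

theorem Xs_eq_vpow_Xv (k : MI d) : Xs k = vpow Xv k := Xs_eq_vpow k

/-- A real vector as a vector in an algebra. -/
def cst {B : Type*} [CommRing B] [Algebra ℝ B] (z : Fin (d + 1) → ℝ) (j : Fin (d + 1)) : B :=
  algebraMap ℝ B (z j)

theorem cst_add {B : Type*} [CommRing B] [Algebra ℝ B] (z w : Fin (d + 1) → ℝ) :
    (cst (z + w) : Fin (d + 1) → B) = cst z + cst w := by
  funext j; simp [cst]

theorem cst_neg {B : Type*} [CommRing B] [Algebra ℝ B] (z : Fin (d + 1) → ℝ) :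
    (cst (-z) : Fin (d + 1) → B) = -cst z := by
  funext j; simp [cst]

theorem cst_zero {B : Type*} [CommRing B] [Algebra ℝ B] :
    (cst (0 : Fin (d + 1) → ℝ) : Fin (d + 1) → B) = 0 := by
  funext j; simp [cst]

theorem map_cst {A B : Type*} [CommRing A] [Algebra ℝ A] [CommRing B] [Algebra ℝ B]
    (φ : A →ₐ[ℝ] B) (z : Fin (d + 1) → ℝ) (j : Fin (d + 1)) : φ (cst z j) = cst z j :=
  φ.commutes _

theorem map_Xp (g : Plus d α κ 2 →ₐ[ℝ] ℝ) (k : MI d) : g (Xp α κ 2 k) = vpow (onX g) k := by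
  simp [Xp, vpow, onX]

/-- The truncated sum `∑_{|l|_𝔰 < N} z^l / l! g(𝓘^{+,2}_{a+l}(u))`. -/
noncomputable def taylorI {B : Type*} [CommRing B] [Algebra ℝ B] (g : Plus d α κ 2 →ₐ[ℝ] ℝ) (N : ℝ)
    (z : Fin (d + 1) → B) (a : MI d) : Span d →ₗ[ℝ] B where
  toFun u := taylor N z (fun b => algebraMap ℝ B (g (Ip α κ 2 b u))) a
  map_add' u v := by simp only [map_add, taylor_add]
  map_smul' c u := by
    simp only [taylor, map_smul, smul_eq_mul, map_mul, RingHom.id_apply, Finset.smul_sum]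
    refine Finset.sum_congr rfl fun l _ => ?_
    rw [smul_comm c, Algebra.smul_def c]
    congr 1
    ring

/-! ### Taylor sums of characters with a uniform cut-off. -/

section TaylorI

variable {A B : Type*} [CommRing A] [Algebra ℝ A] [CommRing B] [Algebra ℝ B]
  (g : Plus d α κ 2 →ₐ[ℝ] ℝ) (N : ℝ)

theorem taylorI_apply (z : Fin (d + 1) → B) (a : MI d) (u : Span d) :
    taylorI g N z a u = taylor N z (fun b => algebraMap ℝ B (g (Ip α κ 2 b u))) a := rfl

theorem map_taylorI (φ : A →ₐ[ℝ] B) (z : Fin (d + 1) → A) (a : MI d) (u : Span d) :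
    φ (taylorI g N z a u) = taylorI g N (fun j => φ (z j)) a u := by
  simp [taylorI_apply, map_taylor]

theorem algebraMap_taylorI (z : Fin (d + 1) → ℝ) (a : MI d) (u : Span d) :
    algebraMap ℝ B (taylorI g N z a u) = taylorI g N (cst z) a u :=
  map_taylorI g N (Algebra.ofId ℝ B) z a u

theorem taylorI_eq_zero_of_isPoly (z : Fin (d + 1) → B) (a : MI d) {u : Span d}
    (hu : u ∈ spanOn (Tree.IsPoly (d := d))) : taylorI g N z a u = 0 := by
  simp [taylorI_apply, taylor, Ip_eq_zero_of_isPoly hu]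

theorem taylorI_eq_zero {D : ℝ} {u : Span d} (hu : u ∈ degLE d α κ D) (z : Fin (d + 1) → B)
    {a : MI d} (ha : D + 2 ≤ a.size) :
    taylorI g N z a u = 0 := by
  refine Finset.sum_eq_zero fun l _ => ?_
  beta_reduce
  rw [Ip_eq_zero_of_mem_degLE hu, map_zero, map_zero, mul_zero, smul_zero]
  rw [size_add, Nat.cast_add]
  linarith [Nat.cast_nonneg (α := ℝ) l.size]

variable {N} {D : ℝ} (hN : D + 2 ≤ N) {u : Span d} (hu : u ∈ degLE d α κ D)
include hN hu

theorem taylor_taylorI (z w : Fin (d + 1) → B) (a : MI d) :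
    taylor N z (fun b => taylorI g N w b u) a = taylorI g N (z + w) a u := by
  simp only [taylorI_apply]
  refine taylor_taylor z w (fun b hb => ?_) a
  rw [Ip_eq_zero_of_mem_degLE hu (hN.trans hb), map_zero, map_zero]

end TaylorI

/-- Only monomials with $|l|_{\mathfrak s}<D$ survive: the vanishing of the coefficients is the
source of the strict bound on monomials. -/
theorem taylor_Xv_mem_degLE' {N D : ℝ} {a : MI d} {c : MI d → ℝ}
    (hc : ∀ l : MI d, D ≤ l.size → c (a + l) = 0) :
    taylor N Xv (fun b => algebraMap ℝ (Span d) (c b)) a ∈ degLE' d α κ D := by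
  refine sum_mem fun l _ => ?_
  beta_reduce
  by_cases hl : D ≤ l.size
  · rw [hc l hl, map_zero, mul_zero, smul_zero]; exact zero_mem _
  · rw [← Algebra.commutes, ← Algebra.smul_def, ← Xs_eq_vpow_Xv]
    exact Submodule.smul_mem _ _ (Submodule.smul_mem _ _ (Xs_mem_degLE' (not_le.1 hl)))

theorem act_Xs (g : Plus d α κ 2 →ₐ[ℝ] ℝ) (k : MI d) :
    act g (Xs k) = vpow (Xv + cst (onX g)) k := by
  rw [Xs, act_tr, treeCoact, Tree.lift_X, map_prod]
  simp [vpow, slice_tmul, Xv, cst, onX, Algebra.algebraMap_eq_smul_one]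

theorem act_Xv (g : Plus d α κ 2 →ₐ[ℝ] ℝ) (j : Fin (d + 1)) :
    act g (Xv j) = Xv j + cst (onX g) j := by
  rw [Xv, act_Xs, vpow, Finset.prod_eq_single j]
  · simp [Xv]
  · intro i _ hi; simp [Pi.single_eq_of_ne hi]
  · simp

theorem act_noise (g : Plus d α κ 2 →ₐ[ℝ] ℝ) : act g (tr Tree.noise) = tr Tree.noise := by
  rw [act_tr, treeCoact, Tree.lift_noise, slice_tmul, map_one, one_smul]

theorem act_dnoise (g : Plus d α κ 2 →ₐ[ℝ] ℝ) :
    act g (tr Tree.dnoise) = tr Tree.dnoise + g (dnoisep α κ 2) • 1 := by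
  rw [act_tr, treeCoact, Tree.lift_dnoise, map_add, slice_tmul, slice_tmul, map_one, one_smul]

/-- The action is an algebra map that fixes scalars and translates $X$ by $g(X)$, so it only moves
the base point. -/
theorem act_taylorI (g h : Plus d α κ 2 →ₐ[ℝ] ℝ) (N : ℝ) (z : Fin (d + 1) → ℝ)
    (a : MI d) (u : Span d) :
    act g (taylorI h N (Xv + cst z) a u) = taylorI h N (Xv + cst (onX g + z)) a u := by
  rw [map_taylorI]
  congr 2
  funext j
  rw [Pi.add_apply, map_add, act_Xv, map_cst, cst_add, ← add_assoc]
  rfl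

/-- The double sum over $l,m$ in $\Delta_2\mathcal I_a(\sigma)$ becomes a Taylor sum at $X$ whose
coefficients are Taylor sums at $g(X)$. Raising both cut-offs to `N` merges them into one sum at
$X+g(X)$. -/
theorem act_plant (g : Plus d α κ 2 →ₐ[ℝ] ℝ) {N : ℝ} (a : MI d) {σ : Tree d} (hσ : ¬ σ.IsPoly)
    (hN : deg α κ 2 σ + 2 ≤ N) :
    act g (tr (σ.plant a)) = graft a (act g (tr σ)) +
      taylorI g N (Xv + cst (onX g)) a (tr σ) := by
  have hu : tr σ ∈ degLE d α κ (deg α κ 2 σ) := tr_mem_spanOn le_rfl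
  rw [act_tr, treeCoact, Tree.lift_plant _ _ _ _ _ hσ, ← treeCoact, map_add, slice_graft, ← act_tr,
    ← taylor_taylorI g hN hu]
  congr 1
  have hle : degI α κ 2 a σ ≤ N := by
    have := Nat.cast_nonneg (α := ℝ) a.size
    unfold degI; linarith
  rw [← sum_below_eq_taylor hle, map_sum]
  · refine Finset.sum_congr rfl fun l _ => ?_
    have h1 : taylorI g N (onX g) (a + l) (tr σ) =
        ∑ m ∈ below d (degI α κ 2 a σ - (l.size : ℝ)), (m.fact : ℝ)⁻¹ •
          (vpow (onX g) m * g (Ip α κ 2 (a + l + m) (tr σ))) := by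
      refine (sum_below_eq_taylor (c := fun b => g (Ip α κ 2 b (tr σ))) ?_ _ ?_).symm
      · linarith [Nat.cast_nonneg (α := ℝ) l.size]
      · intro m hm
        rw [Ip_tr_eq_zero, map_zero]
        right
        simp only [degI, size_add, Nat.cast_add] at hm ⊢
        linarith
    rw [← algebraMap_taylorI, h1, ← Algebra.commutes, ← Algebra.smul_def, Finset.sum_smul,
      Finset.smul_sum, map_sum]
    refine Finset.sum_congr rfl fun m _ => ?_
    rw [slice_tmul, map_smul, map_mul, map_Xp, Xs_eq_vpow, smul_comm]
    rfl
  · intro l hl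
    refine taylorI_eq_zero g N hu _ ?_
    simp only [degI, size_add, Nat.cast_add] at hl ⊢
    linarith

/-- A multiplicative map is triangular for `deg_2` as soon as it is so on the generators. -/
theorem triangular_of_generators (hpos : 0 < degDnoise d α κ 2) (φ : Span d →ₐ[ℝ] Span d)
    (hX : ∀ k : MI d, φ (Xs k) ∈ spanOn fun τ : Tree d => τ.IsPoly ∧ deg α κ 2 τ ≤ k.size)
    (hn : φ (tr Tree.noise) = tr Tree.noise)
    (hd : ∃ c : ℝ, φ (tr Tree.dnoise) = tr Tree.dnoise + c • 1)
    (hp : ∀ a σ, ¬ σ.IsPoly → φ (tr σ) ∈ degLE d α κ (deg α κ 2 σ) →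
      φ (tr (σ.plant a)) ∈ degLE' d α κ (degI α κ 2 a σ)) (τ : Tree d) :
    (τ.IsPoly → φ (tr τ) ∈ spanOn fun σ : Tree d => σ.IsPoly ∧ deg α κ 2 σ ≤ deg α κ 2 τ) ∧
      (¬ τ.IsPoly → φ (tr τ) ∈ degLE' d α κ (deg α κ 2 τ)) := by
  induction τ using Tree.induction with
  | hX k =>
    refine ⟨fun _ => ?_, fun h => absurd (Tree.isPoly_X k) h⟩
    rw [deg_X]; exact hX k
  | hn =>
    refine ⟨fun h => absurd h Tree.not_isPoly_noise, fun h => ?_⟩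
    rw [hn]; exact tr_mem_spanOn ⟨le_rfl, fun h' => absurd h' h⟩
  | hd =>
    refine ⟨fun h => absurd h Tree.not_isPoly_dnoise, fun h => ?_⟩
    obtain ⟨c, hc⟩ := hd
    -- The new term is a multiple of the monomial $X^0$; its degree $0$ lies strictly below that of
    -- $\dot\Xi$ exactly by `hpos`.
    rw [hc, deg_dnoise, ← tr_one]
    refine add_mem (tr_mem_spanOn ⟨le_rfl, fun h' => absurd h' h⟩) (Submodule.smul_mem _ _
      (tr_mem_spanOn ⟨?_, fun _ => ?_⟩)) <;> rw [deg_one] <;> [exact hpos.le; exact hpos]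
  | hm σ τ h1 h2 =>
    rw [tr_mul, map_mul, deg_mul, Tree.isPoly_mul]
    -- A monomial in the image of a product comes from monomials in the images of both factors; a
    -- factor that was not itself a monomial supplies the strict inequality.
    by_cases hσ : σ.IsPoly <;> by_cases hτ : τ.IsPoly
    · refine ⟨fun _ => mul_mem_spanOn (fun σ' τ' h h' => ?_) (h1.1 hσ) (h2.1 hτ),
        fun h => absurd ⟨hσ, hτ⟩ h⟩
      exact ⟨Tree.isPoly_mul.2 ⟨h.1, h'.1⟩, by rw [deg_mul]; exact add_le_add h.2 h'.2⟩
    · refine ⟨fun h => absurd h.2 hτ, fun _ => mul_mem_spanOn (fun σ' τ' h h' => ?_)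
        (h1.1 hσ) (h2.2 hτ)⟩
      rw [deg_mul]
      exact ⟨add_le_add h.2 h'.1, fun hp =>
        add_lt_add_of_le_of_lt h.2 (h'.2 (Tree.isPoly_mul.1 hp).2)⟩
    · refine ⟨fun h => absurd h.1 hσ, fun _ => mul_mem_spanOn (fun σ' τ' h h' => ?_)
        (h1.2 hσ) (h2.1 hτ)⟩
      rw [deg_mul]
      exact ⟨add_le_add h.1 h'.2, fun hp =>
        add_lt_add_of_lt_of_le (h.2 (Tree.isPoly_mul.1 hp).1) h'.2⟩
    · refine ⟨fun h => absurd h.1 hσ, fun _ => mul_mem_spanOn (fun σ' τ' h h' => ?_)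
        (h1.2 hσ) (h2.2 hτ)⟩
      rw [deg_mul]
      exact ⟨add_le_add h.1 h'.1, fun hp =>
        add_lt_add_of_lt_of_le (h.2 (Tree.isPoly_mul.1 hp).1) h'.1⟩
  | hp a τ hτ ih =>
    refine ⟨fun h => absurd h (Tree.not_isPoly_plant a hτ), fun _ => ?_⟩
    rw [deg_plant _ _ _ _ hτ]
    exact hp a τ hτ (degLE'_le (ih.2 hτ))

/-! ### Triangular maps preserve the degree filtrations. -/

section Triangular

variable {φ : Span d →ₐ[ℝ] Span d} (h : ∀ τ : Tree d,
  (τ.IsPoly → φ (tr τ) ∈ spanOn fun σ : Tree d => σ.IsPoly ∧ deg α κ 2 σ ≤ deg α κ 2 τ) ∧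
    (¬ τ.IsPoly → φ (tr τ) ∈ degLE' d α κ (deg α κ 2 τ)))
include h

theorem map_mem_degLE {D : ℝ} {u : Span d} (hu : u ∈ degLE d α κ D) : φ u ∈ degLE d α κ D :=
  map_mem_of_mem_spanOn φ.toLinearMap (fun τ hτ => by
    by_cases hp : τ.IsPoly
    · exact spanOn_mono (fun σ hσ => hσ.2.trans hτ) ((h τ).1 hp)
    · exact spanOn_mono (fun σ hσ => hσ.1.trans hτ) ((h τ).2 hp)) hu

theorem map_mem_degLE' {D : ℝ} {u : Span d} (hu : u ∈ degLE' d α κ D) : φ u ∈ degLE' d α κ D :=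
  map_mem_of_mem_spanOn φ.toLinearMap (fun τ hτ => by
    by_cases hp : τ.IsPoly
    · exact spanOn_mono (fun σ hσ => ⟨hσ.2.trans hτ.1, fun _ => hσ.2.trans_lt (hτ.2 hp)⟩)
        ((h τ).1 hp)
    · exact spanOn_mono (fun σ hσ => ⟨hσ.1.trans hτ.1, fun hp' => (hσ.2 hp').trans_le hτ.1⟩)
        ((h τ).2 hp)) hu

theorem map_mem_isPoly {u : Span d} (hu : u ∈ spanOn (Tree.IsPoly (d := d))) :
    φ u ∈ spanOn (Tree.IsPoly (d := d)) :=
  map_mem_of_mem_spanOn φ.toLinearMap (fun τ hτ =>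
    spanOn_mono (fun _ hσ => hσ.1) ((h τ).1 hτ)) hu

end Triangular

theorem act_triangular (hpos : 0 < degDnoise d α κ 2) (g : Plus d α κ 2 →ₐ[ℝ] ℝ) (τ : Tree d) :
    (τ.IsPoly → act g (tr τ) ∈ spanOn fun σ : Tree d => σ.IsPoly ∧ deg α κ 2 σ ≤ deg α κ 2 τ) ∧
      (¬ τ.IsPoly → act g (tr τ) ∈ degLE' d α κ (deg α κ 2 τ)) := by
  refine triangular_of_generators hpos _ (fun k => ?_) (act_noise g) ⟨_, act_dnoise g⟩
    (fun a σ hσ ih => ?_) τ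
  · have h0 : (k.fact : ℝ) ≠ 0 :=
      Nat.cast_ne_zero.2 (Finset.prod_ne_zero_iff.2 fun j _ => Nat.factorial_ne_zero _)
    -- The factor $k!/k!$ is inserted to match the divided-power binomial theorem.
    rw [act_Xs, ← one_smul ℝ (vpow _ k), ← mul_inv_cancel₀ h0, mul_smul, vpow_add_fact]
    refine Submodule.smul_mem _ _ (sum_mem fun l hl => Submodule.smul_mem _ _ ?_)
    have h1 : vpow (cst (onX g)) (k - l) = algebraMap ℝ (Span d) (vpow (onX g) (k - l)) :=
      (map_vpow (Algebra.ofId ℝ (Span d)) _ _).symm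
    rw [h1, ← Algebra.commutes, ← Algebra.smul_def]
    refine Submodule.smul_mem _ _ ?_
    rw [← Xs_eq_vpow_Xv]
    refine tr_mem_spanOn ⟨Tree.isPoly_X l, ?_⟩
    rw [deg_X]
    exact_mod_cast Finset.sum_le_sum fun j _ => Nat.mul_le_mul_left _ (Finset.mem_Iic.1 hl j)
  · have hu : tr σ ∈ degLE d α κ (deg α κ 2 σ) := tr_mem_spanOn le_rfl
    -- Splitting the base point $X+g(X)$ again exhibits the coefficient of each $X^l$, which
    -- vanishes for $|l|_{\mathfrak s}\ge\deg_2\mathcal I_a\sigma$.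
    rw [act_plant g a hσ le_rfl, ← taylor_taylorI g le_rfl hu]
    refine add_mem (graft_mem_degLE' ih a) ?_
    simp only [← algebraMap_taylorI]
    refine taylor_Xv_mem_degLE' fun l hl => taylorI_eq_zero g _ hu _ ?_
    simp only [degI, size_add, Nat.cast_add] at hl ⊢
    linarith

/-- Linear extension of `act_plant`. Monomials cause no defect: the action keeps them in the span of
monomials, where $\mathcal I_a$ and $\mathcal I^+_b$ both vanish. -/
theorem act_graft (hpos : 0 < degDnoise d α κ 2) (g : Plus d α κ 2 →ₐ[ℝ] ℝ) {N D : ℝ}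
    (hN : D + 2 ≤ N) (a : MI d) {u : Span d} (hu : u ∈ degLE d α κ D) :
    act g (graft a u) = graft a (act g u) + taylorI g N (Xv + cst (onX g)) a u := by
  refine eq_of_mem_spanOn ((act g).toLinearMap ∘ₗ graft a)
    (graft a ∘ₗ (act g).toLinearMap + taylorI g N (Xv + cst (onX g)) a) (fun τ hτ => ?_) hu
  simp only [LinearMap.comp_apply, LinearMap.add_apply, AlgHom.toLinearMap_apply]
  by_cases hp : τ.IsPoly
  · have h1 : tr τ ∈ spanOn (Tree.IsPoly (d := d)) := tr_mem_spanOn hp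
    rw [graft_eq_zero_of_isPoly h1, taylorI_eq_zero_of_isPoly g N _ _ h1,
      graft_eq_zero_of_isPoly (map_mem_isPoly (act_triangular hpos g) h1)]
    simp
  · rw [graft_tr_of_not_isPoly a hp, act_plant g (N := N) a hp (by linarith)]

end Act

/-! ### Re-expansion of planted trees -/

section Antipode

variable {d : ℕ} {α κ : ℝ}

/-- The linear functional on trees underlying the antipode formula. -/
noncomputable def antipodeFun (f : Plus d α κ 2 →ₐ[ℝ] ℝ) (a : MI d) : Span d →ₗ[ℝ] ℝ :=
  extend fun τ => ∑ l ∈ below d (degI α κ 2 a τ),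
    (l.fact : ℝ)⁻¹ • (vpow (onX f) l * f (Ip α κ 2 (a + l) (tr τ)))

/-- Multiplicativity of `f` lets the second tensor factor be evaluated first. -/
theorem apply_antipodeSum (f : Plus d α κ 2 →ₐ[ℝ] ℝ) (a : MI d)
    (w : Span d ⊗[ℝ] Plus d α κ 2) :
    f (antipodeSum α κ 2 a w) = antipodeFun f a (slice f w) := by
  induction w using TensorProduct.induction_on with
  | zero => simp
  | add s t hs ht => simp only [map_add, hs, ht]
  | tmul u p =>
    rw [slice_tmul, map_smul, smul_eq_mul, mul_comm]
    simp only [antipodeSum, TensorProduct.lift.tmul, LinearMap.compl₁₂_apply, LinearMap.id_apply,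
      LinearMap.mul_apply', map_mul]
    congr 1
    refine eq_of_mem_spanOn (f.toLinearMap ∘ₗ extend _) (antipodeFun f a) (fun τ _ => ?_)
      (mem_spanOn_true u)
    rw [LinearMap.comp_apply, extend_tr, antipodeFun, extend_tr, AlgHom.toLinearMap_apply, map_sum]
    refine Finset.sum_congr rfl fun l _ => ?_
    rw [map_smul, map_mul, map_Xp, mul_comm]

theorem antipodeFun_eq_taylorI (f : Plus d α κ 2 →ₐ[ℝ] ℝ) (a : MI d) {N D : ℝ} (hN : D + 2 ≤ N)
    {u : Span d} (hu : u ∈ degLE d α κ D) :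
    antipodeFun f a u = taylorI f N (onX f) a u := by
  refine eq_of_mem_spanOn (antipodeFun f a) (taylorI f N (onX f) a) (fun τ hτ => ?_) hu
  rw [antipodeFun, extend_tr]
  refine sum_below_eq_taylor (c := fun b => f (Ip α κ 2 b (tr τ))) ?_ _ ?_
  · have := Nat.cast_nonneg (α := ℝ) a.size
    unfold degI; linarith
  · intro l hl
    rw [Ip_tr_eq_zero, map_zero]
    right
    simp only [degI, size_add, Nat.cast_add] at hl ⊢
    linarith

theorem slice_map (f : Plus d α κ 2 →ₐ[ℝ] ℝ) (S : Plus d α κ 2 →ₐ[ℝ] Plus d α κ 2)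
    (w : Span d ⊗[ℝ] Plus d α κ 2) :
    slice f (Algebra.TensorProduct.map (AlgHom.id ℝ (Span d)) S w) = slice (f.comp S) w := by
  induction w using TensorProduct.induction_on with
  | zero => simp
  | add s t hs ht => simp only [map_add, hs, ht]
  | tmul u p => simp [slice_tmul]

/-- The antipode formula, evaluated on a character. -/
theorem apply_antipode_Ip (hpos : 0 < degDnoise d α κ 2) (f : Plus d α κ 2 →ₐ[ℝ] ℝ) {N D : ℝ}
    (hN : D + 2 ≤ N) (b : MI d) {u : Span d} (hu : u ∈ degLE d α κ D) :
    f.comp (antipode α κ 2) (Ip α κ 2 b u) =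
      -taylorI f N (onX f) b (act (f.comp (antipode α κ 2)) u) := by
  refine eq_of_mem_spanOn ((f.comp (antipode α κ 2)).toLinearMap ∘ₗ Ip α κ 2 b)
    (-(taylorI f N (onX f) b ∘ₗ (act (f.comp (antipode α κ 2))).toLinearMap))
    (fun τ hτ => ?_) hu
  simp only [LinearMap.comp_apply, LinearMap.neg_apply, AlgHom.toLinearMap_apply]
  have hT := act_triangular hpos (f.comp (antipode α κ 2))
  have h2 : act (f.comp (antipode α κ 2)) (tr τ) ∈ degLE d α κ (deg α κ 2 τ) :=
    map_mem_degLE hT (tr_mem_spanOn le_rfl)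
  by_cases hp : τ.IsPoly
  · have h1 : tr τ ∈ spanOn (Tree.IsPoly (d := d)) := tr_mem_spanOn hp
    rw [Ip_eq_zero_of_isPoly h1, taylorI_eq_zero_of_isPoly _ _ _ _ (map_mem_isPoly hT h1)]
    simp
  · by_cases hdeg : 0 < degI α κ 2 b τ
    · rw [AlgHom.comp_apply, antipode_I α κ 2 b τ hp hdeg, map_neg, apply_antipodeSum, slice_map,
        ← AlgHom.comp_apply, ← act, antipodeFun_eq_taylorI f b (N := N) (by linarith) h2]
    -- In nonpositive degree both sides vanish, since the action does not raise `deg 2`.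
    · rw [Ip_tr_eq_zero α κ 2 b (Or.inr (not_lt.1 hdeg)),
        taylorI_eq_zero f N h2 _ (by unfold degI at hdeg; linarith)]
      simp

/-- Each coefficient is itself a Taylor sum at $f(X)$ by the antipode formula, so the two sums merge
at $z+f(X)$. -/
theorem taylorI_antipode (hpos : 0 < degDnoise d α κ 2) (f : Plus d α κ 2 →ₐ[ℝ] ℝ) {N D : ℝ}
    (hN : D + 2 ≤ N) {B : Type*} [CommRing B] [Algebra ℝ B] (z : Fin (d + 1) → B) (b : MI d)
    {u : Span d} (hu : u ∈ degLE d α κ D) :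
    taylorI (f.comp (antipode α κ 2)) N z b u =
      -taylorI f N (z + cst (onX f)) b (act (f.comp (antipode α κ 2)) u) := by
  rw [taylorI_apply]
  simp only [apply_antipode_Ip hpos f hN _ hu, map_neg, taylor_neg, algebraMap_taylorI]
  rw [taylor_taylorI f hN (map_mem_degLE (act_triangular hpos _) hu)]

/-- The character `(g ⊗ f) Δ⁺_2`. -/
noncomputable def convolve (g f : Plus d α κ 2 →ₐ[ℝ] ℝ) : Plus d α κ 2 →ₐ[ℝ] ℝ :=
  (Algebra.TensorProduct.lmul' ℝ).comp ((Algebra.TensorProduct.map g f).comp (coprod α κ 2))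

theorem onX_convolve (g f : Plus d α κ 2 →ₐ[ℝ] ℝ) : onX (convolve g f) = onX g + onX f := by
  funext j
  simp [onX, convolve, coprod]

theorem convolve_dnoisep (g f : Plus d α κ 2 →ₐ[ℝ] ℝ) :
    convolve g f (dnoisep α κ 2) = g (dnoisep α κ 2) + f (dnoisep α κ 2) := by
  simp [dnoisep, convolve, coprod]

theorem neg_one_pow_mul_vpow (z : Fin (d + 1) → ℝ) (l : MI d) :
    (-1) ^ (∑ j, l j) * vpow z l = vpow (-z) l := by
  rw [vpow, vpow, ← Finset.prod_pow_eq_pow_sum, ← Finset.prod_mul_distrib]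
  exact Finset.prod_congr rfl fun j _ => by rw [← mul_pow, Pi.neg_apply, neg_one_mul]

/-- The coproduct formula, evaluated on a pair of characters. -/
theorem convolve_Ip (hpos : 0 < degDnoise d α κ 2) (g f : Plus d α κ 2 →ₐ[ℝ] ℝ) {N D : ℝ}
    (hN : D + 2 ≤ N) (b : MI d) {u : Span d} (hu : u ∈ degLE d α κ D) :
    convolve g f (Ip α κ 2 b u) =
      f (Ip α κ 2 b u) + taylorI g N (-onX f) b (act f u) := by
  refine eq_of_mem_spanOn ((convolve g f).toLinearMap ∘ₗ Ip α κ 2 b)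
    (f.toLinearMap ∘ₗ Ip α κ 2 b + taylorI g N (-onX f) b ∘ₗ (act f).toLinearMap)
    (fun τ hτ => ?_) hu
  simp only [LinearMap.comp_apply, LinearMap.add_apply, AlgHom.toLinearMap_apply]
  have hT := act_triangular hpos f
  have h2 : act f (tr τ) ∈ degLE d α κ (deg α κ 2 τ) := map_mem_degLE hT (tr_mem_spanOn le_rfl)
  by_cases hp : τ.IsPoly
  · have h1 : tr τ ∈ spanOn (Tree.IsPoly (d := d)) := tr_mem_spanOn hp
    rw [Ip_eq_zero_of_isPoly h1, taylorI_eq_zero_of_isPoly _ _ _ _ (map_mem_isPoly hT h1)]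
    simp
  · by_cases hdeg : 0 < degI α κ 2 b τ
    · have hI : Ip α κ 2 b (tr τ) = MvPolynomial.X (PlusGen.I b τ hp hdeg) := by
        rw [Ip, extend_tr, dif_pos ⟨hp, hdeg⟩]
      have hw : ∀ (l : MI d) (p : Plus d α κ 2) (w : Span d ⊗[ℝ] Plus d α κ 2),
          Algebra.TensorProduct.lmul' ℝ (Algebra.TensorProduct.map g f
            (TensorProduct.map (Ip α κ 2 (b + l)) (LinearMap.mulLeft ℝ p) w)) =
          f p * g (Ip α κ 2 (b + l) (slice f w)) := fun l p w => by
        induction w using TensorProduct.induction_on with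
        | zero => simp
        | add s t hs ht => simp only [map_add, hs, ht, mul_add]
        | tmul u q => simp [slice_tmul]; ring
      have hle : degI α κ 2 b τ ≤ N := by
        have := Nat.cast_nonneg (α := ℝ) b.size
        unfold degI; linarith
      have hs := sum_below_eq_taylor hle (-onX f) (a := b)
        (c := fun b => g (Ip α κ 2 b (act f (tr τ)))) (fun l hl => by
          rw [Ip_eq_zero_of_mem_degLE h2, map_zero]
          simp only [degI, size_add, Nat.cast_add] at hl ⊢
          linarith)
      have hs' : taylorI g N (-onX f) b (act f (tr τ)) = _ := hs.symm
      rw [hs']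
      conv_lhs => rw [hI, convolve, AlgHom.comp_apply, AlgHom.comp_apply, coprod,
        MvPolynomial.aeval_X]
      simp only [map_add, map_sum, hw]
      rw [add_comm]
      congr 1
      · simp
      -- The sign $(-1)^{\sum_j l_j}$ in the coproduct turns the base point $f(X)$ into $-f(X)$.
      · refine Finset.sum_congr rfl fun l _ => ?_
        rw [map_smul, map_Xp, ← neg_one_pow_mul_vpow, smul_eq_mul, smul_eq_mul, act,
          AlgHom.comp_apply]
        ring
    · rw [Ip_tr_eq_zero α κ 2 b (Or.inr (not_lt.1 hdeg)),
        taylorI_eq_zero g N h2 _ (by unfold degI at hdeg; linarith)]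
      simp

/-- The character `(g 𝓐⁺_2 ⊗ f) Δ⁺_2`. -/
noncomputable abbrev transition (g f : Plus d α κ 2 →ₐ[ℝ] ℝ) : Plus d α κ 2 →ₐ[ℝ] ℝ :=
  convolve (g.comp (antipode α κ 2)) f

theorem onX_antipode (f : Plus d α κ 2 →ₐ[ℝ] ℝ) : onX (f.comp (antipode α κ 2)) = -onX f := by
  funext j
  simp [onX, antipode]

theorem antipode_dnoisep (f : Plus d α κ 2 →ₐ[ℝ] ℝ) :
    f.comp (antipode α κ 2) (dnoisep α κ 2) = -f (dnoisep α κ 2) := by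
  simp [dnoisep, antipode]

theorem onX_transition (g f : Plus d α κ 2 →ₐ[ℝ] ℝ) : onX (transition g f) = -onX g + onX f := by
  rw [transition, onX_convolve, onX_antipode]

/-- The coproduct formula contributes the shift by $-f(X)$, and removing the antipode contributes
the sign and the shift by $g(X)$. -/
theorem taylorI_transition (hpos : 0 < degDnoise d α κ 2) (g f : Plus d α κ 2 →ₐ[ℝ] ℝ) {N D : ℝ}
    (hN : D + 2 ≤ N) {B : Type*} [CommRing B] [Algebra ℝ B] (z : Fin (d + 1) → B) (b : MI d)
    {u : Span d} (hu : u ∈ degLE d α κ D) :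
    taylorI (transition g f) N z b u = taylorI f N z b u -
      taylorI g N (z - cst (onX f) + cst (onX g)) b
        (act (g.comp (antipode α κ 2)) (act f u)) := by
  have hu' := map_mem_degLE (act_triangular hpos f) hu
  rw [taylorI_apply]
  simp only [transition, convolve_Ip hpos _ f hN _ hu, map_add, algebraMap_taylorI, taylor_add]
  rw [taylor_taylorI _ hN hu', taylorI_antipode hpos g hN _ _ hu', cst_neg, ← sub_eq_add_neg,
    ← sub_eq_add_neg]
  rfl

/-- The action of a transition character factorises. -/
theorem act_transition (hpos : 0 < degDnoise d α κ 2) (g f : Plus d α κ 2 →ₐ[ℝ] ℝ) (u : Span d) :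
    act (transition g f) u = act (g.comp (antipode α κ 2)) (act f u) := by
  suffices h : ∀ τ : Tree d, act (transition g f) (tr τ) =
      act (g.comp (antipode α κ 2)) (act f (tr τ)) from
    eq_of_mem_spanOn (act (transition g f)).toLinearMap
      ((act (g.comp (antipode α κ 2))).toLinearMap ∘ₗ (act f).toLinearMap)
      (fun τ _ => h τ) (mem_spanOn_true u)
  intro τ
  induction τ using Tree.induction with
  | hX k =>
    change act _ (Xs k) = act _ (act f (Xs k))
    rw [act_Xs, act_Xs, map_vpow, onX_transition]
    congr 1
    funext j
    rw [Pi.add_apply, Pi.add_apply, map_add, act_Xv, map_cst, onX_antipode, cst_add, add_assoc]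
    rfl
  | hn => simp only [act_noise]
  | hd =>
    rw [act_dnoise, act_dnoise, map_add, map_smul, map_one, act_dnoise, transition,
      convolve_dnoisep, antipode_dnoisep, add_smul, add_assoc]
  | hm σ τ h1 h2 => simp only [tr_mul, map_mul, h1, h2]
  | hp a τ hp ih =>
    have hu : tr τ ∈ degLE d α κ (deg α κ 2 τ) := tr_mem_spanOn le_rfl
    rw [← graft_tr_of_not_isPoly a hp, act_graft hpos _ le_rfl a hu, act_graft hpos f le_rfl a hu,
      map_add, act_graft hpos _ le_rfl a (map_mem_degLE (act_triangular hpos f) hu), ih,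
      act_taylorI, taylorI_transition hpos g f le_rfl _ _ hu,
      taylorI_antipode hpos g le_rfl _ _ (map_mem_degLE (act_triangular hpos f) hu),
      onX_transition, onX_antipode, cst_add, cst_neg]
    -- The planted parts agree by induction and the `f`-sums share a base point; this identity
    -- matches the base points of the two `g`-sums.
    have e1 : (Xv + (-cst (onX g) + cst (onX f)) - cst (onX f) + cst (onX g) :
        Fin (d + 1) → Span d) = Xv + -cst (onX g) + cst (onX g) := by abel
    rw [e1]
    abel

/-- This is $\Gamma_{xx}=\mathrm{id}$. On planted trees the two Taylor sums have the same base
point, and by induction the same argument, so they cancel. -/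
theorem act_transition_self (hpos : 0 < degDnoise d α κ 2) (f : Plus d α κ 2 →ₐ[ℝ] ℝ)
    (u : Span d) : act (transition f f) u = u := by
  suffices h : ∀ τ : Tree d, act (transition f f) (tr τ) = tr τ from
    eq_of_mem_spanOn (act (transition f f)).toLinearMap LinearMap.id (fun τ _ => h τ)
      (mem_spanOn_true u)
  have h0 : onX (transition f f) = 0 := by rw [onX_transition, neg_add_cancel]
  intro τ
  induction τ using Tree.induction with
  | hX k =>
    change act _ (Xs k) = Xs k
    rw [act_Xs, h0, cst_zero, add_zero, Xs_eq_vpow_Xv]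
  | hn => exact act_noise _
  | hd =>
    rw [act_dnoise, transition, convolve_dnoisep, antipode_dnoisep, neg_add_cancel, zero_smul,
      add_zero]
  | hm σ τ h1 h2 => simp only [tr_mul, map_mul, h1, h2]
  | hp a τ hp ih =>
    have hu : tr τ ∈ degLE d α κ (deg α κ 2 τ) := tr_mem_spanOn le_rfl
    rw [← graft_tr_of_not_isPoly a hp, act_graft hpos _ le_rfl a hu,
      taylorI_transition hpos f f le_rfl _ _ hu, ← act_transition hpos, ih, sub_add_cancel,
      sub_self, add_zero]

/-- The abstract integration operator corrected by its (abstract) Taylor polynomial intertwines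
the re-expansion maps. -/
theorem act_transition_graft (hpos : 0 < degDnoise d α κ 2) (g f : Plus d α κ 2 →ₐ[ℝ] ℝ)
    {N D : ℝ} (hN : D + 2 ≤ N) (a : MI d) {u : Span d} (hu : u ∈ degLE d α κ D) :
    act (transition g f) (graft a u - taylorI f N Xv a u) =
      graft a (act (transition g f) u) - taylorI g N Xv a (act (transition g f) u) := by
  have h1 := act_taylorI (transition g f) f N 0 a u
  rw [cst_zero, add_zero, add_zero] at h1
  -- The shifts compensate, so the `g`-sum is based at $X$ itself, while the `f`-sum cancels against
  -- the transported Taylor polynomial.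
  have e1 : (Xv + cst (onX (transition g f)) - cst (onX f) + cst (onX g) :
        Fin (d + 1) → Span d) = Xv := by
    rw [onX_transition, cst_add, cst_neg]; abel
  rw [map_sub, act_graft hpos _ hN a hu, h1, taylorI_transition hpos g f hN _ _ hu, e1,
    act_transition hpos]
  abel

end Antipode

/-! ### The action of `Δ̂_2` -/

section Hat

variable {d : ℕ} {α κ : ℝ}

theorem dnoiseCount_mul (σ τ : Tree d) :
    (σ * τ).dnoiseCount = σ.dnoiseCount + τ.dnoiseCount := by
  simp [Tree.dnoiseCount]

theorem dnoiseCount_plant (a : MI d) {τ : Tree d} (h : ¬ τ.IsPoly) :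
    (τ.plant a).dnoiseCount = τ.dnoiseCount := by
  rw [Tree.dnoiseCount, Tree.lift_plant _ _ _ _ _ h, Tree.dnoiseCount]

theorem dnoiseCount_dnoise : (Tree.dnoise : Tree d).dnoiseCount = 1 := rfl

theorem deg_two_eq_deg_zero (τ : Tree d) (h : τ.dnoiseCount = 0) : deg α κ 2 τ = deg α κ 0 τ := by
  induction τ using Tree.induction with
  | hX k => rw [deg_X, deg_X]
  | hn => rfl
  | hd => rw [dnoiseCount_dnoise] at h; omega
  | hm σ τ h1 h2 =>
    rw [dnoiseCount_mul] at h
    rw [deg_mul, deg_mul, h1 (by omega), h2 (by omega)]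
  | hp a τ hp ih =>
    rw [dnoiseCount_plant a hp] at h
    rw [deg_plant _ _ _ _ hp, deg_plant _ _ _ _ hp, degI, degI, ih h]

/-- The Malliavin derivative raises `deg_2` by the regularity gain and preserves `deg_0`. -/
theorem DXi_mem_spanOn (τ : Tree d) (h : τ.dnoiseCount = 0) :
    DXi (tr τ) ∈ spanOn fun σ : Tree d => ¬ σ.IsPoly ∧ deg α κ 0 σ = deg α κ 0 τ ∧
      deg α κ 2 σ = deg α κ 0 τ + (((d : ℝ) + 2) / 2 + 2 * κ) := by
  induction τ using Tree.induction with
  | hX k => rw [DXi_X]; exact zero_mem _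
  | hn =>
    rw [DXi_noise]
    refine tr_mem_spanOn ⟨Tree.not_isPoly_dnoise, ?_, ?_⟩
    · rw [deg_dnoise, deg_noise, degDnoise, if_pos rfl]
    · rw [deg_dnoise, deg_noise, degDnoise, if_neg (by decide), if_neg (by decide), add_assoc]
  | hd => rw [dnoiseCount_dnoise] at h; omega
  | hm σ τ h1 h2 =>
    rw [dnoiseCount_mul] at h
    rw [DXi_mul]
    refine add_mem
      (mul_mem_spanOn (q := fun ρ => ρ = τ) ?_ (h1 (by omega)) (tr_mem_spanOn rfl))
      (mul_mem_spanOn (p := fun ρ => ρ = σ) ?_ (tr_mem_spanOn rfl) (h2 (by omega)))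
    · rintro σ' _ ⟨hp, h0, hk⟩ rfl
      refine ⟨fun h => hp (Tree.isPoly_mul.1 h).1, by rw [deg_mul, deg_mul, h0], ?_⟩
      rw [deg_mul, deg_mul, hk, deg_two_eq_deg_zero _ (by omega)]
      ring
    · rintro _ τ' rfl ⟨hp, h0, hk⟩
      refine ⟨fun h => hp (Tree.isPoly_mul.1 h).2, by rw [deg_mul, deg_mul, h0], ?_⟩
      rw [deg_mul, deg_mul, hk, deg_two_eq_deg_zero _ (by omega)]
      ring
  | hp a τ hp ih =>
    rw [dnoiseCount_plant a hp] at h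
    rw [DXi_plant a hp]
    refine map_mem_of_mem_spanOn (graft a) (fun σ hσ => ?_) (ih h)
    rw [graft_tr_of_not_isPoly a hσ.1]
    refine tr_mem_spanOn ⟨Tree.not_isPoly_plant a hσ.1, ?_, ?_⟩
    · rw [deg_plant _ _ _ _ hσ.1, deg_plant _ _ _ _ hp, degI, degI, hσ.2.1]
    · rw [deg_plant _ _ _ _ hσ.1, deg_plant _ _ _ _ hp, degI, degI, hσ.2.2]
      ring

/-- The map `(id ⊗ f) Δ̂_2`. -/
noncomputable def hatAct (f : Plus d α κ 2 →ₐ[ℝ] ℝ) : Span d →ₐ[ℝ] Span d :=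
  (slice f).comp (hatDelta α κ 2)

theorem hatAct_tr (f : Plus d α κ 2 →ₐ[ℝ] ℝ) (τ : Tree d) :
    hatAct f (tr τ) = slice f (treeHatDelta α κ 2 τ) := by
  rw [hatAct, AlgHom.comp_apply, hatDelta, tr, MonoidAlgebra.lift_of]

/-- The action of a character on `tailSum`. -/
noncomputable def tailFun (f : Plus d α κ 2 →ₐ[ℝ] ℝ) (η : ℝ) (a : MI d) : Span d →ₗ[ℝ] Span d :=
  extend fun τ => ∑ l ∈ (below d (degI α κ 2 a τ)).filter (fun l => η ≤ (l.size : ℝ)),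
    ((l.fact : ℝ)⁻¹ * f (Ip α κ 2 (a + l) (tr τ))) • Xs l

theorem slice_tailSum (f : Plus d α κ 2 →ₐ[ℝ] ℝ) (η : ℝ) (a : MI d)
    (w : Span d ⊗[ℝ] Plus d α κ 2) :
    slice f (tailSum α κ 2 η a w) = tailFun f η a (slice f w) := by
  induction w using TensorProduct.induction_on with
  | zero => simp
  | add s t hs ht => simp only [map_add, hs, ht]
  | tmul u p =>
    rw [slice_tmul, map_smul]
    simp only [tailSum, TensorProduct.lift.tmul, LinearMap.compl₁₂_apply,
      LinearMap.mul_apply', map_mul, AlgHom.toLinearMap_apply,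
      Algebra.TensorProduct.includeRight_apply, slice_tmul]
    rw [mul_smul_comm, mul_one]
    congr 1
    refine eq_of_mem_spanOn ((slice f).toLinearMap ∘ₗ extend _) (tailFun f η a) (fun τ _ => ?_)
      (mem_spanOn_true u)
    rw [LinearMap.comp_apply, extend_tr, tailFun, extend_tr, AlgHom.toLinearMap_apply, map_sum]
    refine Finset.sum_congr rfl fun l _ => ?_
    rw [slice_tmul, smul_smul, mul_comm]

theorem taylorI_Xv_tr (f : Plus d α κ 2 →ₐ[ℝ] ℝ) {N : ℝ} (a : MI d) {τ : Tree d}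
    (hN : deg α κ 2 τ + 2 ≤ N) :
    taylorI f N Xv a (tr τ) = ∑ l ∈ below d (degI α κ 2 a τ),
      ((l.fact : ℝ)⁻¹ * f (Ip α κ 2 (a + l) (tr τ))) • Xs l := by
  rw [taylorI_apply, ← sum_below_eq_taylor (M := degI α κ 2 a τ)]
  · refine Finset.sum_congr rfl fun l _ => ?_
    rw [← Algebra.commutes, ← Algebra.smul_def, smul_smul, Xs_eq_vpow_Xv]
  · have := Nat.cast_nonneg (α := ℝ) a.size
    unfold degI; linarith
  · intro l hl
    rw [Ip_tr_eq_zero, map_zero, map_zero]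
    right
    simp only [degI, size_add, Nat.cast_add] at hl ⊢
    linarith

theorem proj_Xs (η : ℝ) (l : MI d) :
    proj α κ η (Xs l) = if (l.size : ℝ) < η then Xs l else 0 := by
  rw [proj, Xs, extend_tr, deg_X]

/-- Since $\deg_2X^l=|l|_{\mathfrak s}$, removing the terms kept by $P_\eta$ from the full Taylor
polynomial leaves exactly the tail. -/
theorem tailFun_eq (f : Plus d α κ 2 →ₐ[ℝ] ℝ) {N D : ℝ} (hN : D + 2 ≤ N) (η : ℝ) (a : MI d)
    {u : Span d} (hu : u ∈ degLE d α κ D) :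
    tailFun f η a u = taylorI f N Xv a u - proj α κ η (taylorI f N Xv a u) := by
  refine eq_of_mem_spanOn (tailFun f η a)
    (taylorI f N Xv a - proj α κ η ∘ₗ taylorI f N Xv a) (fun τ hτ => ?_) hu
  rw [LinearMap.sub_apply, LinearMap.comp_apply, taylorI_Xv_tr f (N := N) a (by linarith), map_sum,
    ← Finset.sum_sub_distrib, tailFun, extend_tr, Finset.sum_filter]
  refine Finset.sum_congr rfl fun l _ => ?_
  rw [map_smul, proj_Xs]
  by_cases h : (l.size : ℝ) < η
  · rw [if_pos h, if_neg (not_le.2 h), sub_self]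
  · rw [if_neg h, if_pos (not_lt.1 h), smul_zero, sub_zero]

theorem hatAct_plant (f : Plus d α κ 2 →ₐ[ℝ] ℝ) (a : MI d) {σ : Tree d} (hσ : ¬ σ.IsPoly) :
    hatAct f (tr (σ.plant a)) = graft a (hatAct f (tr σ)) -
      tailFun f (degI α κ 0 a σ) a (hatAct f (tr σ)) := by
  rw [hatAct_tr, hatAct_tr, treeHatDelta, Tree.lift_plant _ _ _ _ _ hσ, ← treeHatDelta, map_sub,
    slice_graft, slice_tailSum]

theorem hatAct_noise (f : Plus d α κ 2 →ₐ[ℝ] ℝ) : hatAct f (tr Tree.noise) = tr Tree.noise := by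
  rw [hatAct_tr, treeHatDelta, Tree.lift_noise, slice_tmul, map_one, one_smul]

theorem hatAct_dnoise (f : Plus d α κ 2 →ₐ[ℝ] ℝ) :
    hatAct f (tr Tree.dnoise) = tr Tree.dnoise - f (dnoisep α κ 2) • 1 := by
  rw [hatAct_tr, treeHatDelta, Tree.lift_dnoise, map_sub, slice_tmul, slice_tmul, map_one, one_smul]

theorem hatAct_Xs (f : Plus d α κ 2 →ₐ[ℝ] ℝ) (k : MI d) : hatAct f (Xs k) = Xs k := by
  rw [Xs, hatAct_tr, treeHatDelta, Tree.lift_X, map_prod]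
  simp only [map_pow, slice_tmul, map_one, one_smul]
  exact (Xs_eq_vpow k).symm

/-- The tail at a planted tree only creates monomials $X^l$ with $|l|_{\mathfrak s}$ strictly below
the degree of that tree. -/
theorem hatAct_triangular (hpos : 0 < degDnoise d α κ 2) (f : Plus d α κ 2 →ₐ[ℝ] ℝ) (τ : Tree d) :
    (τ.IsPoly → hatAct f (tr τ) ∈ spanOn fun σ : Tree d => σ.IsPoly ∧ deg α κ 2 σ ≤ deg α κ 2 τ) ∧
      (¬ τ.IsPoly → hatAct f (tr τ) ∈ degLE' d α κ (deg α κ 2 τ)) := by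
  refine triangular_of_generators hpos _ (fun k => ?_) (hatAct_noise f)
    ⟨-f (dnoisep α κ 2), by rw [hatAct_dnoise, neg_smul, sub_eq_add_neg]⟩ (fun a σ hσ ih => ?_) τ
  · rw [hatAct_Xs]
    exact tr_mem_spanOn ⟨Tree.isPoly_X k, (deg_X α κ 2 k).le⟩
  · rw [hatAct_plant f a hσ]
    refine sub_mem (graft_mem_degLE' ih a)
      (map_mem_of_mem_spanOn (tailFun f _ a) (fun ρ hρ => ?_) ih)
    rw [tailFun, extend_tr]
    refine sum_mem fun l hl => Submodule.smul_mem _ _ (Xs_mem_degLE' ?_)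
    have := mem_below.1 (Finset.mem_filter.1 hl).1
    unfold degI at this ⊢
    linarith

/-- Without $\dot\Xi$ the degrees `deg 0` and `deg 2` coincide, so the range
$\deg_0\le|l|_{\mathfrak s}<\deg_2$ of the tail is empty. -/
theorem hatAct_tr_of_dnoiseCount_eq_zero (f : Plus d α κ 2 →ₐ[ℝ] ℝ) (τ : Tree d)
    (h : τ.dnoiseCount = 0) : hatAct f (tr τ) = tr τ := by
  induction τ using Tree.induction with
  | hX k => exact hatAct_Xs f k
  | hn => exact hatAct_noise f
  | hd => rw [dnoiseCount_dnoise] at h; omega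
  | hm σ τ h1 h2 =>
    rw [dnoiseCount_mul] at h
    rw [tr_mul, map_mul, h1 (by omega), h2 (by omega)]
  | hp a τ hp ih =>
    rw [dnoiseCount_plant a hp] at h
    rw [hatAct_plant f a hp, ih h, graft_tr_of_not_isPoly a hp, tailFun, extend_tr,
      Finset.sum_eq_zero, sub_zero]
    intro l hl
    rw [Finset.mem_filter, mem_below, degI, degI, deg_two_eq_deg_zero τ h] at hl
    exact absurd hl.1 (not_lt.2 hl.2)

/-- The threshold of the tail depends on the tree being planted; a common `deg 0` equal to `c`
allows one projection to serve the whole combination. -/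
theorem hatAct_graft (hpos : 0 < degDnoise d α κ 2) (f : Plus d α κ 2 →ₐ[ℝ] ℝ) {N D c : ℝ}
    (hN : D + 2 ≤ N) (a : MI d) {u : Span d}
    (hu : u ∈ spanOn fun σ : Tree d => ¬ σ.IsPoly ∧ deg α κ 0 σ = c ∧ deg α κ 2 σ = D) :
    hatAct f (graft a u) = graft a (hatAct f u) - taylorI f N Xv a (hatAct f u) +
      proj α κ (c + 2 - a.size) (taylorI f N Xv a (hatAct f u)) := by
  have hu' : hatAct f u ∈ degLE d α κ D :=
    map_mem_degLE (hatAct_triangular hpos f) (spanOn_mono (fun _ h => h.2.2.le) hu)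
  rw [sub_add, ← tailFun_eq f hN _ _ hu']
  refine eq_of_mem_spanOn ((hatAct f).toLinearMap ∘ₗ graft a)
    (graft a ∘ₗ (hatAct f).toLinearMap - tailFun f (c + 2 - a.size) a ∘ₗ (hatAct f).toLinearMap)
    (fun σ hσ => ?_) hu
  simp only [LinearMap.comp_apply, LinearMap.sub_apply, AlgHom.toLinearMap_apply]
  rw [graft_tr_of_not_isPoly a hσ.1, hatAct_plant f a hσ.1, degI, hσ.2.1]

end Hat

/-! ### The kernel -/

section Kernel

variable {d : ℕ}

theorem mderiv_zero (a : MI d) : mderiv a (0 : Pt d → ℝ) = 0 := by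
  have h1 : ∀ j, partialDeriv j (0 : Pt d → ℝ) = 0 := fun j => by
    funext y
    simp [partialDeriv]
  have h2 : ∀ j n, (partialDeriv j)^[n] (0 : Pt d → ℝ) = 0 := fun j n =>
    Function.iterate_fixed (h1 j) n
  unfold mderiv
  generalize List.finRange (d + 1) = L
  induction L with
  | nil => rfl
  | cons j L ih => rw [List.foldr_cons, ih, h2]

theorem integrable_mul_mpow {K : Pt d → ℝ} (hKint : MeasureTheory.Integrable K)
    (hKsupp : HasCompactSupport K) (k : MI d) :
    MeasureTheory.Integrable fun z => K z * mpow z k := by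
  have hc : Continuous fun z : Pt d => mpow z k := by unfold mpow; fun_prop
  have h1 : MeasureTheory.IntegrableOn (fun z => K z * mpow z k) (tsupport K) :=
    hKint.integrableOn.mul_continuousOn hc.continuousOn hKsupp
  rwa [MeasureTheory.integrableOn_iff_integrable_of_support_subset] at h1
  exact fun z hz => subset_tsupport K fun h => hz (by simp [h])

/-- Expanding $(y-t-x)^k$ in powers of $t$ produces only moments of order at most $|k|_{\mathfrak
s}<r$. The convolution therefore vanishes identically before differentiation, and no condition on
`a` is needed. -/
theorem conv_mpow {K : Pt d → ℝ} (hKint : MeasureTheory.Integrable K)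
    (hKsupp : HasCompactSupport K) {r : ℝ}
    (hKmom : ∀ k : MI d, (k.size : ℝ) < r → ∫ z, K z * mpow z k = 0) (a k : MI d)
    (hk : (k.size : ℝ) < r) (x : Pt d) : conv K a (fun y => mpow (y - x) k) = 0 := by
  suffices h : MeasureTheory.convolution K (fun y => mpow (y - x) k) (ContinuousLinearMap.mul ℝ ℝ)
      MeasureTheory.volume = 0 by rw [conv, h, mderiv_zero]
  funext y
  rw [MeasureTheory.convolution_def, Pi.zero_apply]
  have h0 : (k.fact : ℝ) ≠ 0 :=
    Nat.cast_ne_zero.2 (Finset.prod_ne_zero_iff.2 fun j _ => Nat.factorial_ne_zero _)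
  have h1 : ∀ t : Pt d, ContinuousLinearMap.mul ℝ ℝ (K t) (mpow (y - t - x) k) =
      ∑ l ∈ Finset.Iic k, (k.fact * ((l.fact : ℝ)⁻¹ * ((k - l).fact : ℝ)⁻¹) * vpow (y - x) l *
        (-1) ^ (∑ j, (k - l) j)) * (K t * mpow t (k - l)) := fun t => by
    have e : mpow (y - t - x) k = k.fact * ((k.fact : ℝ)⁻¹ • vpow ((y - x) + (-t)) k) := by
      rw [smul_eq_mul, mul_inv_cancel_left₀ h0, show y - t - x = y - x + -t by abel]
      rfl
    rw [ContinuousLinearMap.mul_apply', e, vpow_add_fact, Finset.mul_sum, Finset.mul_sum]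
    refine Finset.sum_congr rfl fun l _ => ?_
    rw [← neg_one_pow_mul_vpow, smul_eq_mul, show mpow t (k - l) = vpow t (k - l) from rfl]
    ring
  simp only [h1]
  rw [MeasureTheory.integral_finsetSum _ fun l _ =>
    (integrable_mul_mpow hKint hKsupp (k - l)).const_mul _]
  refine Finset.sum_eq_zero fun l _ => ?_
  rw [MeasureTheory.integral_const_mul, hKmom, mul_zero]
  refine lt_of_le_of_lt ?_ hk
  exact_mod_cast Finset.sum_le_sum fun j _ => Nat.mul_le_mul_left _ (Nat.sub_le _ _)

end Kernel

/-! ### The renormalised model -/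

section Model

variable {d : ℕ} {α κ : ℝ} (R : PreparationMap d α κ) (K ξ δξ : Pt d → ℝ)

theorem Gam_eq_act (x y : Pt d) : Gam α κ R K ξ δξ 2 x y =
    act (transition (char α κ R K ξ δξ 2 x) (char α κ R K ξ δξ 2 y)) := rfl

theorem char_dnoisep (x : Pt d) : char α κ R K ξ δξ 2 x (dnoisep α κ 2) = -δξ x := by
  simp [char, dnoisep]

theorem dGam_apply (y x : Pt d) (u : Span d) : dGam α κ R K ξ δξ y x u =
    Gam α κ R K ξ δξ 2 y x (hatAct (char α κ R K ξ δξ 2 x) (DXi u)) := by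
  rw [dGam, hatAct, LinearMap.comp_apply, LinearMap.comp_apply, LinearMap.comp_apply,
    AlgHom.comp_apply]
  generalize DXi u = v
  rw [AlgHom.toLinearMap_apply]
  generalize hatDelta α κ 2 v = w
  induction w using TensorProduct.induction_on with
  | zero => simp
  | tmul s p => simp [slice_tmul]
  | add s t hs ht => simp only [map_add, hs, ht]

/-- On non-monomial trees both sides have the same coefficients by the definition of `char`. On
monomials the right side is zero by convention and the left side by the moment condition, as
$|k|_{\mathfrak s}<D\le r$. -/
theorem J_eq_neg_taylorI {r : ℝ} (hKint : MeasureTheory.Integrable K)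
    (hKsupp : HasCompactSupport K)
    (hKmom : ∀ k : MI d, (k.size : ℝ) < r → ∫ z, K z * mpow z k = 0) (x : Pt d) (a : MI d)
    {N D : ℝ} (hN : D + 2 ≤ N) (hD : D ≤ r) {u : Span d} (hu : u ∈ degLE' d α κ D) :
    J α κ R K ξ δξ 2 x a u = -taylorI (char α κ R K ξ δξ 2 x) N Xv a u := by
  refine eq_of_mem_spanOn (J α κ R K ξ δξ 2 x a) (-taylorI (char α κ R K ξ δξ 2 x) N Xv a)
    (fun τ hτ => ?_) hu
  rw [LinearMap.neg_apply, J, extend_tr]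
  by_cases hp : τ.IsPoly
  · rw [taylorI_eq_zero_of_isPoly _ _ _ _ (tr_mem_spanOn hp), neg_zero]
    refine Finset.sum_eq_zero fun l _ => ?_
    have hlt := hτ.2 hp
    obtain ⟨k, rfl⟩ := hp
    rw [deg_X] at hlt
    have hm : model α κ R K ξ δξ 2 x (tr (Tree.X k)) = fun y => mpow (y - x) k := by
      rw [model, LinearMap.comp_apply, ← Xs, R.map_X, modelTimes_X]
    rw [hm, conv_mpow hKint hKsupp hKmom _ k (hlt.trans_le hD), Pi.zero_apply, zero_div, zero_smul]
  · rw [taylorI_Xv_tr _ (N := N) a (by linarith [hτ.1]), ← Finset.sum_neg_distrib]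
    refine Finset.sum_congr rfl fun l hl => ?_
    have hd : 0 < degI α κ 2 (a + l) τ := by
      have := mem_below.1 hl
      simp only [degI, size_add, Nat.cast_add] at this ⊢
      linarith
    rw [Ip, extend_tr, dif_pos ⟨hp, hd⟩, char, MvPolynomial.aeval_X, mul_neg, neg_smul, neg_neg,
      div_eq_inv_mul]

/-- The map $\hat\Delta_2$ adds $\delta\xi(x)$ and $\Gamma_{yx}$ adds $\delta\xi(y)-\delta\xi(x)$.
-/
theorem dGam_noise (y x : Pt d) :
    dGam α κ R K ξ δξ y x (tr Tree.noise) = tr Tree.dnoise + δξ y • 1 := by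
  rw [dGam_apply, DXi_noise, hatAct_dnoise, map_sub, map_smul, map_one, Gam_eq_act, act_dnoise,
    transition, convolve_dnoisep, antipode_dnoisep, char_dnoisep, char_dnoisep, add_sub_assoc,
    ← sub_smul]
  congr 2
  ring

theorem dGam_Xs (y x : Pt d) (k : MI d) : dGam α κ R K ξ δξ y x (Xs k) = 0 := by
  rw [dGam_apply, Xs, DXi_X, map_zero, map_zero]

theorem DXi_mul' (u v : Span d) : DXi (u * v) = DXi u * v + u * DXi v := by
  refine eq_of_mem_spanOn (DXi ∘ₗ LinearMap.mulRight ℝ v)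
    (LinearMap.mulRight ℝ v ∘ₗ DXi + LinearMap.mulRight ℝ (DXi v)) (fun σ _ => ?_)
    (mem_spanOn_true u)
  refine eq_of_mem_spanOn (DXi ∘ₗ LinearMap.mulLeft ℝ (tr σ))
    (LinearMap.mulLeft ℝ (DXi (tr σ)) + LinearMap.mulLeft ℝ (tr σ) ∘ₗ DXi) (fun τ _ => ?_)
    (mem_spanOn_true v)
  simp only [LinearMap.comp_apply, LinearMap.add_apply, LinearMap.mulLeft_apply, ← tr_mul, DXi_mul]

theorem hatAct_of_mem_Span0 (f : Plus d α κ 2 →ₐ[ℝ] ℝ) {u : Span d} (hu : u ∈ Span0 d) :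
    hatAct f u = u := by
  have h : Span0 d ≤ LinearMap.eqLocus (hatAct f).toLinearMap LinearMap.id :=
    Submodule.span_le.2 (by
      rintro _ ⟨τ, hτ, rfl⟩
      exact hatAct_tr_of_dnoiseCount_eq_zero f τ hτ)
  exact h hu

/-- Both $\Gamma_{yx}$ and `hatAct` are algebra maps, and `hatAct` fixes the factor that $D_\Xi$
leaves undifferentiated. -/
theorem dGam_mul (y x : Pt d) {σ τ : Span d} (hσ : σ ∈ Span0 d) (hτ : τ ∈ Span0 d) :
    dGam α κ R K ξ δξ y x (σ * τ) =
      dGam α κ R K ξ δξ y x τ * Gam α κ R K ξ δξ 2 y x σ +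
        Gam α κ R K ξ δξ 2 y x τ * dGam α κ R K ξ δξ y x σ := by
  simp only [dGam_apply, DXi_mul', map_add, map_mul, hatAct_of_mem_Span0 _ hσ,
    hatAct_of_mem_Span0 _ hτ]
  ring

theorem dGam_graft {r : ℝ} (hpos : 0 < degDnoise d α κ 2) (hKint : MeasureTheory.Integrable K)
    (hKsupp : HasCompactSupport K)
    (hKmom : ∀ k : MI d, (k.size : ℝ) < r → ∫ z, K z * mpow z k = 0) (x y : Pt d) (a : MI d)
    {τ : Tree d} (h0 : τ.dnoiseCount = 0)
    (hr : deg α κ 0 τ + (((d : ℝ) + 2) / 2 + 2 * κ) ≤ r) :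
    dGam α κ R K ξ δξ y x (graft a (tr τ)) =
      (graft a + J α κ R K ξ δξ 2 y a) (dGam α κ R K ξ δξ y x (tr τ)) -
        Gam α κ R K ξ δξ 2 y x (proj α κ (degI α κ 0 a τ)
          (J α κ R K ξ δξ 2 x a (dGam α κ R K ξ δξ x x (tr τ)))) := by
  by_cases hp : τ.IsPoly
  · obtain ⟨k, rfl⟩ := hp
    rw [graft_tr_of_isPoly a (Tree.isPoly_X k), ← Xs, dGam_Xs, dGam_Xs]
    simp
  set f := char α κ R K ξ δξ 2 x with hf
  set g := char α κ R K ξ δξ 2 y with hg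
  have hw := DXi_mem_spanOn (α := α) (κ := κ) τ h0
  -- The derivative contains no monomial, so it starts in `degLE'`; the filtration index is the
  -- quantity bounded by `r`.
  have hv : hatAct f (DXi (tr τ)) ∈
      degLE' d α κ (deg α κ 0 τ + (((d : ℝ) + 2) / 2 + 2 * κ)) :=
    map_mem_degLE' (hatAct_triangular hpos f)
      (spanOn_mono (fun _ h => ⟨h.2.2.le, fun h' => absurd h' h.1⟩) hw)
  have hv' := map_mem_degLE' (act_triangular hpos (transition g f)) hv
  -- Since $\Gamma_{xx}=\mathrm{id}$, the vector `hatAct f (DXi (tr τ))` is $\mathrm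
  -- d\Gamma_{xx}\tau$ and its image under $\Gamma_{yx}$ is $\mathrm d\Gamma_{yx}\tau$; the Taylor
  -- sums at $y$ and $x$ then become the two $\mathcal J$ terms.
  rw [dGam_apply, dGam_apply, dGam_apply, Gam_eq_act, Gam_eq_act, ← hf, ← hg,
    act_transition_self hpos, graft_tr_of_not_isPoly a hp, DXi_plant a hp,
    hatAct_graft hpos f le_rfl a hw, map_add, act_transition_graft hpos g f le_rfl a (degLE'_le hv),
    LinearMap.add_apply, J_eq_neg_taylorI R K ξ δξ hKint hKsupp hKmom y a le_rfl hr hv',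
    J_eq_neg_taylorI R K ξ δξ hKint hKsupp hKmom x a le_rfl hr hv, map_neg, map_neg, sub_neg_eq_add,
    ← sub_eq_add_neg, degI]

end Model

end DecTree

/-! ### The theorem. -/

theorem mainTheorem2 (d : ℕ) (α κ : ℝ) (hκ : 0 < κ)
    (hpos : 0 < DecTree.degDnoise d α κ 2)
    (K ξ δξ : DecTree.Pt d → ℝ)
    (hKint : MeasureTheory.Integrable K) (hKsupp : HasCompactSupport K)
    (r : ℝ) (hKmom : ∀ k : DecTree.MI d, (k.size : ℝ) < r → ∫ z, K z * DecTree.mpow z k = 0)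
    (hξ : ContDiff ℝ ∞ ξ) (hδξ : ContDiff ℝ ∞ δξ)
    (R : DecTree.PreparationMap d α κ) (x y : DecTree.Pt d) :
    (DecTree.dGam α κ R K ξ δξ y x (DecTree.tr DecTree.Tree.noise) =
      DecTree.tr DecTree.Tree.dnoise + δξ y • 1) ∧
    (∀ k : DecTree.MI d, DecTree.dGam α κ R K ξ δξ y x (DecTree.Xs k) = 0) ∧
    (∀ σ ∈ DecTree.Span0 d, ∀ τ ∈ DecTree.Span0 d,
      DecTree.dGam α κ R K ξ δξ y x (σ * τ) =
        DecTree.dGam α κ R K ξ δξ y x τ * DecTree.Gam α κ R K ξ δξ 2 y x σ +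
        DecTree.Gam α κ R K ξ δξ 2 y x τ * DecTree.dGam α κ R K ξ δξ y x σ) ∧
    (∀ (a : DecTree.MI d) (τ : DecTree.Tree d), τ.dnoiseCount = 0 →
      DecTree.deg α κ 0 τ + (((d : ℝ) + 2) / 2 + 2 * κ) ≤ r →
      DecTree.dGam α κ R K ξ δξ y x (DecTree.graft a (DecTree.tr τ)) =
        (DecTree.graft a + DecTree.J α κ R K ξ δξ 2 y a)
          (DecTree.dGam α κ R K ξ δξ y x (DecTree.tr τ)) -
        DecTree.Gam α κ R K ξ δξ 2 y x
          (DecTree.proj α κ (DecTree.degI α κ 0 a τ)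
            (DecTree.J α κ R K ξ δξ 2 x a
              (DecTree.dGam α κ R K ξ δξ x x (DecTree.tr τ))))) := by
  exact ⟨DecTree.dGam_noise R K ξ δξ y x, DecTree.dGam_Xs R K ξ δξ y x,
    fun σ hσ τ hτ => DecTree.dGam_mul R K ξ δξ y x hσ hτ,
    fun a τ h0 hr => DecTree.dGam_graft R K ξ δξ hpos hKint hKsupp hKmom x y a h0 hr⟩
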